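/- Let $\mathcal F^2(\mathbb C)$ be the Fock space of entire functions $F$ with $\|F\|^2=\int_{\mathbb C}|F(z)|^2e^{-\pi|z|^2}\,dz<\infty$, where $dz$ is Lebesgue measure, with scalar product $\langle F,G\rangle=\int_{\mathbb C}F\overline{G}\,e^{-\pi|z|^2}\,dz$. For $F\in\mathcal F^2(\mathbb C)\setminus\{0\}$ put $u_F(z)=|F(z)|^2e^{-\pi|z|^2}$, let $u_F^*(s)=\sup\{t\ge 0:|\{u_F>t\}|>s\}$, and, for fixed $s>0$, define $$\mathcal K[F]=\frac{1}{\|F\|^2}\int_{\{u_F>u_F^*(s)\}}u_F(z)\,dz,\qquad \nabla^2\mathcal K[1](G,G)=\frac{d^2}{d\varepsilon^2}\mathcal K[1+\varepsilon G]\Big|_{\varepsilon=0}\quad(\varepsilon\in\mathbb R).$$ Let $s>0$, and let $G\in\mathcal F^2(\mathbb C)$ satisfy $\|G\|=1$ and $\langle G,1\rangle=\langle G,z\rangle=0$. Then $\varepsilon\mapsto\mathcal K[1+\varepsilon G]$ is twice continuously differentiable in a neighbourhood of $\varepsilon=0$, and $$\tfrac12\nabla^2\mathcal K[1](G,G)\le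 -s\,e^{-s}.$$ Moreover, $G(z)=\sum_{k\ge2}a_k\left(\frac{\pi^k}{k!}\right)^{1/2}z^k$ for some complex coefficients $a_k$ with $\sum_{k\ge2}|a_k|^2=1$, and $$\tfrac12\nabla^2\mathcal K[1](G,G)=\sum_{k\ge2}|a_k|^2V_k(s),\qquad V_k(s)=-e^{-s}\sum_{j=1}^{k-1}\frac{s^j}{j!}.$$ The bound is sharp: if $G(z)=c\,z^2$ with $|c|=\pi/\sqrt2$ (that is, $G$ is a multiple of $z^2$ of norm one), then $G$ satisfies all the hypotheses above and $\tfrac12\nabla^2\mathcal K[1](G,G)=-s\,e^{-s}$. -/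

import Mathlib

open MeasureTheory

noncomputable section

/-- The density `|F(z)|² e^{-π|z|²}` on the complex plane. -/
def fockDensity (F : ℂ → ℂ) (z : ℂ) : ℝ :=
  ‖F z‖ ^ 2 * Real.exp (-Real.pi * ‖z‖ ^ 2)

/-- The Bargmann–Fock space: entire functions `F` with `∫ |F(z)|² e^{-π|z|²} dz < ∞`, where `dz`
is Lebesgue measure on the plane. -/
def fockSpace : Submodule ℂ (ℂ → ℂ) where
  carrier := {F | Differentiable ℂ F ∧ Integrable (fockDensity F)}
  zero_mem' := by
    refine ⟨differentiable_const (0 : ℂ), ?_⟩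
    have h : fockDensity (0 : ℂ → ℂ) = fun _ => 0 := by
      funext z
      simp [fockDensity]
    rw [h]
    exact integrable_zero _ _ _
  add_mem' := by
    rintro F G ⟨hF, hFi⟩ ⟨hG, hGi⟩
    refine ⟨hF.add hG, ((hFi.add hGi).const_mul 2).mono' ?_ ?_⟩
    · have hc : Continuous (F + G) := (hF.add hG).continuous
      have : Continuous (fockDensity (F + G)) := by
        unfold fockDensity
        fun_prop
      exact this.aestronglyMeasurable
    · refine Filter.Eventually.of_forall fun z => ?_
      have he := Real.exp_pos (-Real.pi * ‖z‖ ^ 2)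
      have h1 : ‖F z + G z‖ ^ 2 ≤ 2 * (‖F z‖ ^ 2 + ‖G z‖ ^ 2) := by
        have h2 := norm_add_le (F z) (G z)
        nlinarith [norm_nonneg (F z + G z), sq_nonneg (‖F z‖ - ‖G z‖)]
      simp only [fockDensity, Pi.add_apply]
      rw [Real.norm_of_nonneg (by positivity)]
      nlinarith [mul_le_mul_of_nonneg_right h1 he.le]
  smul_mem' := by
    rintro c F ⟨hF, hFi⟩
    refine ⟨hF.const_smul c, ?_⟩
    have h : fockDensity (c • F) = fun z => ‖c‖ ^ 2 * fockDensity F z := by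
      funext z
      simp [fockDensity, mul_pow, mul_assoc]
    rw [h]
    exact hFi.const_mul _

/-- The scalar product `⟨F, G⟩ = ∫ F(z) conj(G(z)) e^{-π|z|²} dz`. -/
def fockInner (F G : ℂ → ℂ) : ℂ :=
  ∫ z : ℂ, F z * (starRingEnd ℂ) (G z) * (Real.exp (-Real.pi * ‖z‖ ^ 2) : ℂ)

/-- The norm of the Fock space. -/
def fockNorm (F : ℂ → ℂ) : ℝ :=
  Real.sqrt (∫ z : ℂ, fockDensity F z)

/-- The normalized monomials `e_k(z) = (π^k / k!)^{1/2} z^k`. -/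
def fockMonomial (k : ℕ) (z : ℂ) : ℂ :=
  (Real.sqrt (Real.pi ^ k / (k.factorial : ℝ)) : ℂ) * z ^ k

/-- The distribution function `μ_F(t) = |{u_F > t}|` of `u_F(z) = |F(z)|² e^{-π|z|²}`. -/
def fockDistribution (F : ℂ → ℂ) (t : ℝ) : ENNReal :=
  volume {z : ℂ | t < fockDensity F z}

/-- The decreasing rearrangement `u_F^*(s) = sup {t ≥ 0 : μ_F(t) > s}`. -/
def fockRearrangement (F : ℂ → ℂ) (s : ℝ) : ℝ :=
  sSup {t : ℝ | 0 ≤ t ∧ ENNReal.ofReal s < fockDistribution F t}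

/-- `I_F(s)`, the integral of `u_F` over its super-level set `{u_F > u_F^*(s)}`. -/
def fockConcentration (F : ℂ → ℂ) (s : ℝ) : ℝ :=
  ∫ z in {z : ℂ | fockRearrangement F s < fockDensity F z}, fockDensity F z

/-- The functional `𝒦[F] = I_F(s) / ‖F‖²`. -/
def fockK (s : ℝ) (F : ℂ → ℂ) : ℝ :=
  fockConcentration F s / fockNorm F ^ 2

/-- The function `ε ↦ 𝒦[1 + ε G]` of the real variable `ε`. -/
def fockKLine (s : ℝ) (G : ℂ → ℂ) (ε : ℝ) : ℝ :=
  fockK s (fun z => 1 + (ε : ℂ) * G z)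

/-- The second variation `∇²𝒦[1](G, G) = d²/dε² 𝒦[1 + ε G]` at `ε = 0`. -/
def fockSecondVariation (s : ℝ) (G : ℂ → ℂ) : ℝ :=
  iteratedDeriv 2 (fockKLine s G) 0

/-- `V_k(s) = - e^{-s} ∑_{j=1}^{k-1} s^j / j!` (an empty sum for `k ≤ 1`). -/
def fockV (s : ℝ) (k : ℕ) : ℝ :=
  -Real.exp (-s) * ∑ j ∈ Finset.Ico 1 k, s ^ j / (j.factorial : ℝ)

/-- `G` lies in the Fock space, `‖G‖ = 1` and `⟨G, 1⟩ = ⟨G, z⟩ = 0`. -/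
structure FockAdmissible (G : ℂ → ℂ) : Prop where
  mem : G ∈ fockSpace
  norm_eq_one : fockNorm G = 1
  inner_one : fockInner G (fun _ => 1) = 0
  inner_id : fockInner G (fun z => z) = 0

end

/-!
The functional is expanded around `F = 1`, whose density `e^{-π|z|²}` is radial and strictly
decreasing. Write `u_ε = |1 + εG|² e^{-π|z|²} = f₀ + ε f₁ + ε² f₂`.

*Level sets.* The reproducing kernel bound `|G|² e^{-π|z|²} ≤ ‖G‖²` controls `u_ε` at infinity, so
for `(ε, t)` near `(0, e^{-s})` the set `{u_ε > t}` is star-shaped, with a boundary radius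
`R(ε, t, θ)` that is `C¹` by the implicit function theorem (`eventually_regularLevel`,
`contDiffOn_levelRadius`). Hence `∫_{u_ε > t} f` is a `C¹` function of `(ε, t)` for every continuous
`f`, its derivative being a boundary flux (`hasFDerivAt_starIntegral`). For `f = 1` this is the
distribution function, and solving `|{u_ε > t}| = s` gives a `C¹` level `t = φ(ε)`, which is the
decreasing rearrangement at `s` (`RegularLevel.fockRearrangement_eq`).

*Two derivatives.* Let `I(ε)` be the integral of `u_ε` over `{u_ε > φ(ε)}`. On the boundary `u_ε` is
the constant `φ(ε)`, and the enclosed area is constant, so the boundary does not contribute to the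
first derivative: `I' = ∫ f₁ + 2ε ∫ f₂` over the super-level set. The right-hand side is again `C¹`,
and at `ε = 0` its derivative is the flux of `f₁` through the circle `π|z|² = s` plus `2 ∫ f₂` over
the disc; with `‖1 + εG‖² = 1 + ε²` this gives `fockKLine_secondVariation`.

*Power series.* Parseval's identity on circles and the Gaussian moments turn the circle average and
the disc integral of `|G|²` into sums over the coefficients of `G` in the normalized monomials. The
coefficients of `1` and `z` vanish by orthogonality, and `V_k(s) ≤ -s e^{-s}` for `k ≥ 2`, with
equality for `k = 2`.
-/

/-! ### Calculus with a parameter -/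

/-- Differentiation under an integral over a compact interval, for an integrand whose derivative in
the parameter is jointly continuous: the integral is differentiable, with continuous derivative. -/
theorem hasFDerivAt_intervalIntegral_of_continuousOn {E : Type*} [NormedAddCommGroup E]
    [NormedSpace ℝ E] {f : E → ℝ → ℝ} {f' : E → ℝ → E →L[ℝ] ℝ} {U : Set E} (hU : IsOpen U)
    (hf : ∀ x ∈ U, ∀ θ, HasFDerivAt (fun y => f y θ) (f' x θ) x)
    (hf' : ContinuousOn (Function.uncurry f') (U ×ˢ Set.univ))
    (hfc : ∀ x ∈ U, Continuous (f x)) (a b : ℝ) :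
    (∀ x ∈ U, HasFDerivAt (fun y => ∫ θ in a..b, f y θ) (∫ θ in a..b, f' x θ) x) ∧
      ContinuousOn (fun x => ∫ θ in a..b, f' x θ) U := by
  have hca : ∀ x ∈ U, ∀ θ, ContinuousAt (Function.uncurry f') (x, θ) := fun x hx θ =>
    hf'.continuousAt ((hU.prod isOpen_univ).mem_nhds ⟨hx, Set.mem_univ _⟩)
  have hcθ : ∀ x ∈ U, Continuous (f' x) := fun x hx =>
    continuous_iff_continuousAt.2 fun θ =>
      ContinuousAt.comp (f := fun θ : ℝ => (x, θ)) (hca x hx θ) (by fun_prop)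
  have hbd : ∀ x₀ ∈ U, ∃ C : ℝ, ∀ᶠ x in nhds x₀, ∀ θ ∈ Set.uIcc a b, ‖f' x θ‖ ≤ C := by
    intro x₀ hx₀
    obtain ⟨C, hC⟩ := (isCompact_uIcc (a := a) (b := b)).exists_bound_of_continuousOn
      (hcθ x₀ hx₀).continuousOn
    refine ⟨C + 1, isCompact_uIcc.eventually_forall_of_forall_eventually fun θ hθ => ?_⟩
    have h := (hca x₀ hx₀ θ).norm
    have h1 : ‖Function.uncurry f' (x₀, θ)‖ < C + 1 := by
      have := hC θ hθ
      simp only [Function.uncurry]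
      linarith
    filter_upwards [h.eventually_lt continuousAt_const h1] with z hz
    exact hz.le
  constructor
  · intro x₀ hx₀
    obtain ⟨C, hC⟩ := hbd x₀ hx₀
    have hUn := hU.mem_nhds hx₀
    refine intervalIntegral.hasFDerivAt_integral_of_dominated_of_fderiv_le
      (F' := f') (bound := fun _ => C) (s := U ∩ {x | ∀ θ ∈ Set.uIcc a b, ‖f' x θ‖ ≤ C})
      (Filter.inter_mem hUn hC) ?_ ((hfc x₀ hx₀).intervalIntegrable _ _)
      (hcθ x₀ hx₀).aestronglyMeasurable ?_ intervalIntegrable_const ?_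
    · filter_upwards [hUn] with x hx using (hfc x hx).aestronglyMeasurable
    · exact Filter.Eventually.of_forall fun θ hθ x hx => hx.2 θ (Set.uIoc_subset_uIcc hθ)
    · exact Filter.Eventually.of_forall fun θ _ x hx => hf x hx.1 θ
  · intro x₀ hx₀
    obtain ⟨C, hC⟩ := hbd x₀ hx₀
    refine ContinuousAt.continuousWithinAt ?_
    refine intervalIntegral.continuousAt_of_dominated_interval (bound := fun _ => C) ?_ ?_
      intervalIntegrable_const ?_
    · filter_upwards [hU.mem_nhds hx₀] with x hx using (hcθ x hx).aestronglyMeasurable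
    · filter_upwards [hC] with x hx
      exact Filter.Eventually.of_forall fun θ hθ => hx θ (Set.uIoc_subset_uIcc hθ)
    · exact Filter.Eventually.of_forall fun θ _ =>
        ContinuousAt.comp (f := fun x => (x, θ)) (hca x₀ hx₀ θ) (by fun_prop)

/-- The implicit function theorem for one scalar unknown. -/
theorem exists_contDiffAt_implicit {E : Type*} [NormedAddCommGroup E] [NormedSpace ℝ E]
    [CompleteSpace E] {f : E × ℝ → ℝ} {p₀ : E} {r₀ d : ℝ} (hf : ContDiffAt ℝ 1 f (p₀, r₀))
    (hd : HasDerivAt (fun r => f (p₀, r)) d r₀) (hd0 : d ≠ 0) :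
    ∃ φ : E → ℝ, ContDiffAt ℝ 1 φ p₀ ∧ φ p₀ = r₀ ∧ ∀ᶠ p in nhds p₀, f (p, φ p) = f (p₀, r₀) := by
  have hinr : fderiv ℝ f (p₀, r₀) ∘L .inr ℝ E ℝ =
      (ContinuousLinearEquiv.unitsEquivAut ℝ (Units.mk0 d hd0) : ℝ →L[ℝ] ℝ) := by
    have h1 : HasFDerivAt (fun r : ℝ => (p₀, r)) (ContinuousLinearMap.inr ℝ E ℝ) r₀ :=
      hasFDerivAt_prodMk_right p₀ r₀
    have h2 := (hf.differentiableAt one_ne_zero).hasFDerivAt.comp r₀ h1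
    have h3 := h2.unique hd.hasFDerivAt
    rw [h3]
    ext
    simp
  have hinv : (fderiv ℝ f (p₀, r₀) ∘L .inr ℝ E ℝ).IsInvertible := ⟨_, hinr.symm⟩
  exact ⟨hf.implicitFunction one_ne_zero hinv,
    hf.contDiffAt_implicitFunction one_ne_zero hinv,
    hf.implicitFunction_apply_self one_ne_zero hinv,
    hf.eventually_apply_implicitFunction one_ne_zero hinv⟩

/-- A function selecting the only zero in a fixed open interval is continuously differentiable
wherever the implicit function theorem applies. -/
theorem contDiffOn_of_unique_zero {E : Type*} [NormedAddCommGroup E] [NormedSpace ℝ E]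
    [CompleteSpace E] {f : E × ℝ → ℝ} {V : Set E} (hV : IsOpen V) {R : E → ℝ} {a b : ℝ}
    (hR : ∀ p ∈ V, R p ∈ Set.Ioo a b) (hf : ∀ p ∈ V, ContDiffAt ℝ 1 f (p, R p))
    (hd : ∀ p ∈ V, ∃ d : ℝ, d ≠ 0 ∧ HasDerivAt (fun r => f (p, r)) d (R p))
    (hzero : ∀ p ∈ V, f (p, R p) = 0)
    (huniq : ∀ p ∈ V, ∀ r ∈ Set.Ioo a b, f (p, r) = 0 → r = R p) :
    ContDiffOn ℝ 1 R V := by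
  intro p₀ hp₀
  obtain ⟨d, hd0, hd⟩ := hd p₀ hp₀
  obtain ⟨φ, hφ, hφ0, hφe⟩ := exists_contDiffAt_implicit (hf p₀ hp₀) hd hd0
  refine (hφ.congr_of_eventuallyEq ?_).contDiffWithinAt
  have hmem : ∀ᶠ p in nhds p₀, φ p ∈ Set.Ioo a b :=
    hφ.continuousAt.eventually_mem (isOpen_Ioo.mem_nhds (by rw [hφ0]; exact hR p₀ hp₀))
  filter_upwards [hφe, hmem, hV.mem_nhds hp₀] with p h1 h2 h3
  exact (huniq p h3 _ h2 (by rw [h1, hzero p₀ hp₀])).symm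

/-! ### Polar coordinates -/

theorem polarCoord_symm_eq_circleMap (p : ℝ × ℝ) :
    Complex.polarCoord.symm p = circleMap 0 p.1 p.2 := by
  rw [Complex.polarCoord_symm_apply, circleMap, Complex.exp_mul_I]
  simp

theorem volume_restrict_polarCoord_target :
    (volume : Measure (ℝ × ℝ)).restrict polarCoord.target =
      (volume.restrict (Set.Ioi (0 : ℝ))).prod
        (volume.restrict (Set.Ioo (-Real.pi) Real.pi)) := by
  rw [Measure.prod_restrict]
  rfl

theorem continuous_uncurry_circleMap : Continuous fun p : ℝ × ℝ => circleMap 0 p.1 p.2 := by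
  unfold circleMap
  fun_prop

theorem contDiff_uncurry_circleMap {n : WithTop ℕ∞} :
    ContDiff ℝ n fun p : ℝ × ℝ => circleMap 0 p.1 p.2 := by
  have h1 : ContDiff ℝ n fun x : ℝ => (x : ℂ) := Complex.ofRealCLM.contDiff
  have h2 : ContDiff ℝ n fun p : ℝ × ℝ => Complex.exp (p.2 * Complex.I) :=
    ((h1.comp contDiff_snd).mul contDiff_const).cexp
  simpa [circleMap] using (h1.comp contDiff_fst).mul h2

section Polar

variable {E : Type*} [NormedAddCommGroup E] [NormedSpace ℝ E] {h : ℂ → E}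

theorem integrable_polarCoord (hm : StronglyMeasurable h) (hi : Integrable h) :
    Integrable (fun p : ℝ × ℝ => p.1 • h (circleMap 0 p.1 p.2))
      ((volume.restrict (Set.Ioi (0 : ℝ))).prod
        (volume.restrict (Set.Ioo (-Real.pi) Real.pi))) := by
  refine ⟨(measurable_fst.stronglyMeasurable.smul
    (hm.comp_measurable continuous_uncurry_circleMap.measurable)).aestronglyMeasurable, ?_⟩
  rw [← volume_restrict_polarCoord_target]
  have hlt := hi.2
  rw [HasFiniteIntegral, ← Complex.lintegral_comp_polarCoord_symm] at hlt
  rw [HasFiniteIntegral]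
  refine lt_of_le_of_lt (le_of_eq ?_) hlt
  refine setLIntegral_congr_fun polarCoord.open_target.measurableSet fun p hp => ?_
  have hp0 : (0 : ℝ) < p.1 := hp.1
  rw [polarCoord_symm_eq_circleMap, enorm_smul, Real.enorm_of_nonneg hp0.le, smul_eq_mul]

theorem intervalIntegral_circleMap_eq_circleAverage (h : ℂ → E) (r : ℝ) :
    ∫ θ in -Real.pi..Real.pi, h (circleMap 0 r θ) = (2 * Real.pi) • Real.circleAverage h 0 r := by
  have hper : Function.Periodic (fun θ => h (circleMap 0 r θ)) (2 * Real.pi) :=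
    fun x => by simp [periodic_circleMap 0 r x]
  have := hper.intervalIntegral_add_eq (-Real.pi) 0
  rw [zero_add, show -Real.pi + 2 * Real.pi = Real.pi by ring] at this
  rw [this, Real.circleAverage_def, smul_smul, mul_inv_cancel₀ (by positivity), one_smul]

theorem setIntegral_circleMap_eq_circleAverage (h : ℂ → E) (r : ℝ) :
    ∫ θ in Set.Ioo (-Real.pi) Real.pi, h (circleMap 0 r θ) =
      (2 * Real.pi) • Real.circleAverage h 0 r := by
  rw [← integral_Ioc_eq_integral_Ioo, ← intervalIntegral.integral_of_le (by linarith [Real.pi_pos]),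
    intervalIntegral_circleMap_eq_circleAverage]

theorem integral_eq_integral_circleAverage (hm : StronglyMeasurable h) (hi : Integrable h) :
    ∫ z, h z = ∫ r in Set.Ioi (0 : ℝ), (2 * Real.pi * r) • Real.circleAverage h 0 r := by
  rw [← Complex.integral_comp_polarCoord_symm, volume_restrict_polarCoord_target]
  simp_rw [polarCoord_symm_eq_circleMap]
  rw [integral_prod _ (integrable_polarCoord hm hi)]
  congr 1 with r
  simp only
  rw [integral_smul, setIntegral_circleMap_eq_circleAverage, smul_smul, mul_comm r]

theorem integrableOn_circleAverage (hm : StronglyMeasurable h) (hi : Integrable h) :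
    IntegrableOn (fun r => (2 * Real.pi * r) • Real.circleAverage h 0 r) (Set.Ioi (0 : ℝ)) := by
  refine (integrable_polarCoord hm hi).integral_prod_left.congr ?_
  refine Filter.Eventually.of_forall fun r => ?_
  simp only
  rw [integral_smul, setIntegral_circleMap_eq_circleAverage, smul_smul, mul_comm r]

theorem setIntegral_ball_eq_integral_circleAverage (hm : StronglyMeasurable h) {ρ : ℝ}
    (hi : IntegrableOn h (Metric.ball 0 ρ)) :
    ∫ z in Metric.ball 0 ρ, h z =
      ∫ r in Set.Ioo 0 ρ, (2 * Real.pi * r) • Real.circleAverage h 0 r := by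
  have hb : MeasurableSet (Metric.ball (0 : ℂ) ρ) := Metric.isOpen_ball.measurableSet
  rw [← integral_indicator hb,
    integral_eq_integral_circleAverage (hm.indicator hb) ((integrable_indicator_iff hb).2 hi)]
  rw [show Set.Ioo 0 ρ = Set.Ioi 0 ∩ Set.Iio ρ from rfl,
    ← setIntegral_indicator measurableSet_Iio]
  refine setIntegral_congr_fun measurableSet_Ioi fun r (hr : 0 < r) => ?_
  by_cases hrρ : r < ρ
  · rw [Set.indicator_of_mem (show r ∈ Set.Iio ρ from hrρ)]
    congr 1
    refine Real.circleAverage_congr_sphere fun z hz => ?_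
    refine Set.indicator_of_mem ?_ _
    simp only [mem_sphere_iff_norm, sub_zero, abs_of_pos hr] at hz
    simpa [hz] using hrρ
  · rw [Set.indicator_of_notMem (show r ∉ Set.Iio ρ from hrρ)]
    have : Real.circleAverage ((Metric.ball 0 ρ).indicator h) 0 r =
        Real.circleAverage (fun _ => (0 : E)) 0 r := by
      refine Real.circleAverage_congr_sphere fun z hz => ?_
      refine Set.indicator_of_notMem ?_ _
      simp only [mem_sphere_iff_norm, sub_zero, abs_of_pos hr] at hz
      simpa [hz] using hrρ
    rw [this]
    simp [Real.circleAverage_def]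

/-- Integration over a star-shaped region, described by the radius `R θ` it reaches in the
direction `θ`. -/
theorem setIntegral_eq_integral_of_star {Ω : Set ℂ} (hΩ : MeasurableSet Ω) {R : ℝ → ℝ}
    (hR : ∀ θ, 0 ≤ R θ) (hmem : ∀ θ, ∀ r, 0 < r → (circleMap 0 r θ ∈ Ω ↔ r < R θ))
    (hm : StronglyMeasurable h) (hi : IntegrableOn h Ω) :
    ∫ z in Ω, h z =
      ∫ θ in -Real.pi..Real.pi, ∫ r in 0..R θ, r • h (circleMap 0 r θ) := by
  rw [← integral_indicator hΩ, ← Complex.integral_comp_polarCoord_symm,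
    volume_restrict_polarCoord_target]
  simp_rw [polarCoord_symm_eq_circleMap]
  rw [integral_prod_symm _ (integrable_polarCoord (hm.indicator hΩ)
    ((integrable_indicator_iff hΩ).2 hi)),
    intervalIntegral.integral_of_le (by linarith [Real.pi_pos]), integral_Ioc_eq_integral_Ioo]
  congr 1 with θ
  rw [intervalIntegral.integral_of_le (hR θ), integral_Ioc_eq_integral_Ioo,
    show Set.Ioo 0 (R θ) = Set.Ioi 0 ∩ Set.Iio (R θ) from rfl,
    ← setIntegral_indicator measurableSet_Iio]
  refine setIntegral_congr_fun measurableSet_Ioi fun r (hr : 0 < r) => ?_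
  simp only [Set.indicator, hmem θ r hr, Set.mem_Iio]
  split_ifs <;> simp

end Polar

/-! ### Power series on circles -/

theorem circleAverage_of_entire {G : ℂ → ℂ} (hG : Differentiable ℂ G) (r : ℝ) :
    Real.circleAverage G 0 r = G 0 :=
  hG.diffContOnCl.circleAverage

theorem circleAverage_re {h : ℂ → ℂ} (hh : Continuous h) (r : ℝ) :
    Real.circleAverage (fun z => (h z).re) 0 r = (Real.circleAverage h 0 r).re :=
  Complex.reCLM.circleAverage_comp_comm (hh.continuousOn.circleIntegrable')

theorem circleAverage_conj {h : ℂ → ℂ} (hh : Continuous h) (r : ℝ) :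
    Real.circleAverage (fun z => (starRingEnd ℂ) (h z)) 0 r =
      (starRingEnd ℂ) (Real.circleAverage h 0 r) :=
  (Complex.conjCLE : ℂ →L[ℝ] ℂ).circleAverage_comp_comm (hh.continuousOn.circleIntegrable')

theorem hasSum_circleAverage {f : ℕ → ℂ → ℂ} {h : ℂ → ℂ} {r : ℝ} {b : ℕ → ℝ}
    (hf : ∀ k, Continuous (f k)) (hb : Summable b)
    (hbound : ∀ k θ, ‖f k (circleMap 0 r θ)‖ ≤ b k)
    (hsum : ∀ z, HasSum (fun k => f k z) (h z)) :
    HasSum (fun k => Real.circleAverage (f k) 0 r) (Real.circleAverage h 0 r) := by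
  simp_rw [Real.circleAverage_def]
  refine HasSum.const_smul _ ?_
  refine intervalIntegral.hasSum_integral_of_dominated_convergence (fun k _ => b k) ?_ ?_ ?_
    intervalIntegrable_const ?_
  · exact fun k => ((hf k).comp (continuous_circleMap 0 r)).aestronglyMeasurable
  · exact fun k => Filter.Eventually.of_forall fun θ _ => hbound k θ
  · exact Filter.Eventually.of_forall fun _ _ => hb
  · exact Filter.Eventually.of_forall fun θ _ => hsum _

theorem circleAverage_pow_mul_conj_pow (k l : ℕ) (r : ℝ) :
    Real.circleAverage (fun z : ℂ => z ^ k * (starRingEnd ℂ) z ^ l) 0 r =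
      if k = l then (r : ℂ) ^ (2 * k) else 0 := by
  have key : ∀ k l : ℕ, l ≤ k →
      Real.circleAverage (fun z : ℂ => z ^ k * (starRingEnd ℂ) z ^ l) 0 r =
        if k = l then (r : ℂ) ^ (2 * k) else 0 := by
    intro k l hkl
    have h1 : Real.circleAverage (fun z : ℂ => z ^ k * (starRingEnd ℂ) z ^ l) 0 r =
        Real.circleAverage (fun z : ℂ => (r : ℂ) ^ (2 * l) * z ^ (k - l)) 0 r := by
      refine Real.circleAverage_congr_sphere fun z hz => ?_
      simp only [mem_sphere_iff_norm, sub_zero] at hz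
      have h2 : z * (starRingEnd ℂ) z = (r : ℂ) ^ 2 := by
        rw [Complex.mul_conj, Complex.normSq_eq_norm_sq, hz, sq_abs]
        norm_cast
      obtain ⟨m, rfl⟩ := Nat.exists_eq_add_of_le hkl
      simp only [Nat.add_sub_cancel_left]
      rw [pow_add, pow_mul, ← h2, mul_pow]
      ring
    rw [h1, circleAverage_of_entire (by fun_prop)]
    by_cases h : k = l
    · simp [h]
    · rw [if_neg h, zero_pow (by omega), mul_zero]
  rcases le_total l k with h | h
  · exact key k l h
  · have h1 := key l k h
    have h2 := circleAverage_conj (h := fun z : ℂ => z ^ l * (starRingEnd ℂ) z ^ k)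
      (by fun_prop) r
    simp only [map_mul, map_pow, Complex.conj_conj] at h2
    rw [h1] at h2
    rw [show (fun z : ℂ => z ^ k * (starRingEnd ℂ) z ^ l) =
      fun z : ℂ => (starRingEnd ℂ) z ^ l * z ^ k from funext fun z => mul_comm _ _, h2]
    by_cases h3 : k = l
    · simp [h3]
    · rw [if_neg h3, if_neg (Ne.symm h3), map_zero]

section PowerSeries

variable {c : ℕ → ℂ} {G : ℂ → ℂ}

theorem summable_norm_mul_pow (hG : ∀ z, HasSum (fun k => c k * z ^ k) (G z)) (r : ℝ) :
    Summable fun k => ‖c k‖ * |r| ^ k := by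
  have := (hG (r : ℂ)).summable.norm
  simpa [norm_mul, norm_pow] using this

/-- Circle averages against `conj z ^ l` extract the `l`-th coefficient. -/
theorem circleAverage_mul_conj_pow (hG : ∀ z, HasSum (fun k => c k * z ^ k) (G z)) (l : ℕ)
    (r : ℝ) :
    Real.circleAverage (fun z => G z * (starRingEnd ℂ) z ^ l) 0 r = c l * (r : ℂ) ^ (2 * l) := by
  have h1 := hasSum_circleAverage (r := r) (f := fun k z => c k * z ^ k * (starRingEnd ℂ) z ^ l)
    (h := fun z => G z * (starRingEnd ℂ) z ^ l) (b := fun k => ‖c k‖ * |r| ^ k * |r| ^ l)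
    (fun k => by fun_prop) ((summable_norm_mul_pow hG r).mul_right _)
    (fun k θ => by simp [norm_pow]) (fun z => (hG z).mul_right _)
  have h2 : ∀ k, Real.circleAverage (fun z => c k * z ^ k * (starRingEnd ℂ) z ^ l) 0 r =
      if k = l then c l * (r : ℂ) ^ (2 * l) else 0 := by
    intro k
    have h3 := Real.circleAverage_fun_smul (a := c k) (c := 0) (R := r)
      (f := fun z : ℂ => z ^ k * (starRingEnd ℂ) z ^ l)
    simp only [smul_eq_mul, ← mul_assoc] at h3
    rw [h3, circleAverage_pow_mul_conj_pow]
    split_ifs with h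
    · rw [h]
    · simp
  simp_rw [h2] at h1
  exact h1.unique (hasSum_ite_eq l _)

/-- Parseval's identity for an everywhere convergent power series on a circle. -/
theorem hasSum_circleAverage_norm_sq (hd : Differentiable ℂ G)
    (hG : ∀ z, HasSum (fun k => c k * z ^ k) (G z)) (r : ℝ) :
    HasSum (fun k => ‖c k‖ ^ 2 * r ^ (2 * k))
      (Real.circleAverage (fun z => ‖G z‖ ^ 2) 0 r) := by
  have hc := hd.continuous
  obtain ⟨C, hC⟩ := (isCompact_sphere (0 : ℂ) |r|).exists_bound_of_continuousOn hc.continuousOn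
  have h1 := hasSum_circleAverage (r := r)
    (f := fun l z => (starRingEnd ℂ) (c l) * (G z * (starRingEnd ℂ) z ^ l))
    (h := fun z => (starRingEnd ℂ) (G z) * G z) (b := fun l => ‖c l‖ * |r| ^ l * C)
    (fun k => by fun_prop) ((summable_norm_mul_pow hG r).mul_right _)
    (fun k θ => by
      have := hC (circleMap 0 r θ) (by simp)
      simp only [norm_mul, norm_pow, RCLike.norm_conj, norm_circleMap_zero]
      calc ‖c k‖ * (‖G (circleMap 0 r θ)‖ * |r| ^ k) = ‖c k‖ * |r| ^ k * ‖G (circleMap 0 r θ)‖ := by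
            ring
        _ ≤ _ := by gcongr)
    (fun z => by
      have h2 := ((hG z).map (starRingEnd ℂ) Complex.continuous_conj).mul_right (G z)
      refine h2.congr_fun ?_
      intro k
      simp only [Function.comp, map_mul, map_pow]
      ring)
  have h2 : ∀ l, Real.circleAverage (fun z => (starRingEnd ℂ) (c l) *
      (G z * (starRingEnd ℂ) z ^ l)) 0 r = ((‖c l‖ ^ 2 * r ^ (2 * l) : ℝ) : ℂ) := by
    intro l
    have h3 := Real.circleAverage_fun_smul (a := (starRingEnd ℂ) (c l)) (c := 0) (R := r)
      (f := fun z : ℂ => G z * (starRingEnd ℂ) z ^ l)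
    simp only [smul_eq_mul] at h3
    rw [h3, circleAverage_mul_conj_pow hG, ← mul_assoc, Complex.conj_mul']
    push_cast
    rfl
  simp_rw [h2] at h1
  have h4 := Complex.hasSum_re h1
  rw [← circleAverage_re (by fun_prop)] at h4
  simpa only [Complex.ofReal_re, Complex.conj_mul', ← Complex.ofReal_pow] using h4

end PowerSeries

/-! ### Gaussian moments -/

/-- The antiderivative `-(k!/π^k) e^{-πr²} ∑_{j ≤ k} (πr²)^j/j!` of `2πr · r^{2k} e^{-πr²}`. -/
noncomputable def gaussianPrimitive (k : ℕ) (r : ℝ) : ℝ :=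
  -((k.factorial : ℝ) / Real.pi ^ k) * (Real.exp (-Real.pi * r ^ 2) *
    ∑ j ∈ Finset.range (k + 1), (Real.pi * r ^ 2) ^ j / (j.factorial : ℝ))

theorem hasDerivAt_sum_pow_div_factorial (k : ℕ) (x : ℝ) :
    HasDerivAt (fun x : ℝ => ∑ j ∈ Finset.range (k + 1), x ^ j / (j.factorial : ℝ))
      (∑ j ∈ Finset.range k, x ^ j / (j.factorial : ℝ)) x := by
  have h : HasDerivAt (fun x : ℝ => ∑ j ∈ Finset.range (k + 1), x ^ j / (j.factorial : ℝ))
      (∑ j ∈ Finset.range (k + 1), (j : ℝ) * x ^ (j - 1) / (j.factorial : ℝ)) x :=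
    HasDerivAt.fun_sum fun j _ => (hasDerivAt_pow j x).div_const _
  convert h using 1
  rw [Finset.sum_range_succ']
  simp only [Nat.cast_zero, zero_mul, zero_div, add_zero, Nat.add_sub_cancel]
  refine Finset.sum_congr rfl fun j _ => ?_
  rw [Nat.factorial_succ]
  push_cast
  field_simp

theorem hasDerivAt_gaussianPrimitive (k : ℕ) (r : ℝ) :
    HasDerivAt (gaussianPrimitive k)
      (2 * Real.pi * r * (r ^ (2 * k) * Real.exp (-Real.pi * r ^ 2))) r := by
  have h1 : HasDerivAt (fun r : ℝ => Real.pi * r ^ 2) (2 * Real.pi * r) r := by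
    refine ((hasDerivAt_pow 2 r).const_mul Real.pi).congr_deriv ?_
    norm_num
    ring
  have h2 := (hasDerivAt_sum_pow_div_factorial k (Real.pi * r ^ 2)).comp r h1
  have h3 := h1.neg.exp
  have h4 := (h3.mul h2).const_mul (-((k.factorial : ℝ) / Real.pi ^ k))
  have h5 : gaussianPrimitive k = fun r => -((k.factorial : ℝ) / Real.pi ^ k) *
      (Real.exp (-(Real.pi * r ^ 2)) *
        ∑ j ∈ Finset.range (k + 1), (Real.pi * r ^ 2) ^ j / (j.factorial : ℝ)) := by
    funext r
    rw [gaussianPrimitive, neg_mul Real.pi]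
  rw [h5]
  refine h4.congr_deriv ?_
  simp only [Function.comp, Finset.sum_range_succ, neg_mul Real.pi, Pi.neg_apply]
  have : (k.factorial : ℝ) ≠ 0 := by positivity
  field_simp
  ring

theorem gaussianPrimitive_zero (k : ℕ) :
    gaussianPrimitive k 0 = -((k.factorial : ℝ) / Real.pi ^ k) := by
  rw [gaussianPrimitive, Finset.sum_range_succ']
  simp

theorem tendsto_gaussianPrimitive (k : ℕ) :
    Filter.Tendsto (gaussianPrimitive k) Filter.atTop (nhds 0) := by
  have h1 : Filter.Tendsto (fun r : ℝ => Real.pi * r ^ 2) Filter.atTop Filter.atTop :=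
    (Filter.tendsto_pow_atTop two_ne_zero).const_mul_atTop Real.pi_pos
  have h2 : Filter.Tendsto (fun x : ℝ => -((k.factorial : ℝ) / Real.pi ^ k) *
      ∑ j ∈ Finset.range (k + 1), x ^ j * Real.exp (-x) / (j.factorial : ℝ))
      Filter.atTop (nhds 0) := by
    have h3 := (tendsto_finsetSum (Finset.range (k + 1)) fun j _ =>
      (Real.tendsto_pow_mul_exp_neg_atTop_nhds_zero j).div_const (j.factorial : ℝ)).const_mul
        (-((k.factorial : ℝ) / Real.pi ^ k))
    simpa using h3
  refine (h2.comp h1).congr fun r => ?_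
  simp only [Function.comp, gaussianPrimitive, Finset.mul_sum, neg_mul Real.pi]
  refine Finset.sum_congr rfl fun j _ => ?_
  ring

theorem integrableOn_gaussian_moment (k : ℕ) :
    IntegrableOn (fun r : ℝ => 2 * Real.pi * r * (r ^ (2 * k) * Real.exp (-Real.pi * r ^ 2)))
      (Set.Ioi 0) :=
  integrableOn_Ioi_deriv_of_nonneg' (fun r _ => hasDerivAt_gaussianPrimitive k r)
    (fun r (hr : 0 < r) => by positivity) (tendsto_gaussianPrimitive k)

theorem integral_gaussian_moment (k : ℕ) :
    ∫ r in Set.Ioi (0 : ℝ), 2 * Real.pi * r * (r ^ (2 * k) * Real.exp (-Real.pi * r ^ 2)) =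
      (k.factorial : ℝ) / Real.pi ^ k := by
  rw [integral_Ioi_of_hasDerivAt_of_nonneg' (fun r _ => hasDerivAt_gaussianPrimitive k r)
    (fun r (hr : 0 < r) => by positivity) (tendsto_gaussianPrimitive k), gaussianPrimitive_zero]
  ring

theorem integral_gaussian_moment_Ioo (k : ℕ) {ρ : ℝ} (hρ : 0 ≤ ρ) :
    ∫ r in Set.Ioo 0 ρ, 2 * Real.pi * r * (r ^ (2 * k) * Real.exp (-Real.pi * r ^ 2)) =
      (k.factorial : ℝ) / Real.pi ^ k * (1 - Real.exp (-(Real.pi * ρ ^ 2)) *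
        ∑ j ∈ Finset.range (k + 1), (Real.pi * ρ ^ 2) ^ j / (j.factorial : ℝ)) := by
  rw [← integral_Ioc_eq_integral_Ioo, ← intervalIntegral.integral_of_le hρ,
    intervalIntegral.integral_eq_sub_of_hasDerivAt
      (fun r _ => hasDerivAt_gaussianPrimitive k r)
      (Continuous.intervalIntegrable (by fun_prop) _ _), gaussianPrimitive_zero,
    gaussianPrimitive, neg_mul Real.pi]
  ring

/-! ### The Fock space -/

theorem continuous_fockDensity {F : ℂ → ℂ} (hF : Continuous F) : Continuous (fockDensity F) := by
  unfold fockDensity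
  fun_prop

theorem fockDensity_nonneg (F : ℂ → ℂ) (z : ℂ) : 0 ≤ fockDensity F z := by
  unfold fockDensity
  positivity

theorem fockNorm_sq (F : ℂ → ℂ) : fockNorm F ^ 2 = ∫ z, fockDensity F z :=
  Real.sq_sqrt (integral_nonneg fun z => fockDensity_nonneg F z)

theorem integrable_exp_neg_mul_norm_sq {b : ℝ} (hb : 0 < b) :
    Integrable fun z : ℂ => Real.exp (-b * ‖z‖ ^ 2) := by
  have h := (GaussianFourier.integrable_cexp_neg_mul_sq_norm_add (V := ℂ) (b := (b : ℂ))
    (by simpa using hb) 0 0).norm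
  refine h.congr (Filter.Eventually.of_forall fun z => ?_)
  simp only [Complex.norm_exp]
  congr 1
  have : -(b : ℂ) * (‖z‖ : ℂ) ^ 2 + 0 * ((inner ℝ (0 : ℂ) z : ℝ) : ℂ) =
      ((-b * ‖z‖ ^ 2 : ℝ) : ℂ) := by
    push_cast
    ring
  rw [this, Complex.ofReal_re]

theorem pow_mem_fockSpace (k : ℕ) : (fun z : ℂ => z ^ k) ∈ fockSpace := by
  refine ⟨by fun_prop, ?_⟩
  have hπ : 0 < Real.pi - 1 := by linarith [Real.pi_gt_three]
  refine ((integrable_exp_neg_mul_norm_sq hπ).const_mul (k.factorial : ℝ)).mono'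
    (continuous_fockDensity (by fun_prop)).aestronglyMeasurable
    (Filter.Eventually.of_forall fun z => ?_)
  rw [Real.norm_of_nonneg (fockDensity_nonneg _ _), fockDensity]
  -- `x ^ k ≤ k! e ^ x` absorbs the power into the Gaussian.
  have h1 := Real.pow_div_factorial_le_exp (‖z‖ ^ 2) (by positivity) k
  rw [div_le_iff₀ (by positivity)] at h1
  calc ‖z ^ k‖ ^ 2 * Real.exp (-Real.pi * ‖z‖ ^ 2)
      = (‖z‖ ^ 2) ^ k * Real.exp (-Real.pi * ‖z‖ ^ 2) := by rw [norm_pow]; ring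
    _ ≤ Real.exp (‖z‖ ^ 2) * (k.factorial : ℝ) * Real.exp (-Real.pi * ‖z‖ ^ 2) := by gcongr
    _ = (k.factorial : ℝ) * (Real.exp (‖z‖ ^ 2) * Real.exp (-Real.pi * ‖z‖ ^ 2)) := by ring
    _ = _ := by rw [← Real.exp_add]; ring_nf

section Coefficients

variable {c : ℕ → ℂ} {G : ℂ → ℂ}

theorem circleAverage_fockDensity (G : ℂ → ℂ) (r : ℝ) :
    Real.circleAverage (fockDensity G) 0 r =
      Real.exp (-Real.pi * r ^ 2) * Real.circleAverage (fun z => ‖G z‖ ^ 2) 0 r := by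
  have h := Real.circleAverage_fun_smul (a := Real.exp (-Real.pi * r ^ 2)) (c := 0) (R := r)
    (f := fun z : ℂ => ‖G z‖ ^ 2)
  simp only [smul_eq_mul] at h
  rw [← h]
  refine Real.circleAverage_congr_sphere fun z hz => ?_
  simp only [mem_sphere_iff_norm, sub_zero] at hz
  simp only [fockDensity, hz, sq_abs]
  ring

/-- Term-by-term integration of Parseval's identity over a set of radii. -/
theorem hasSum_integral_circleAverage_fockDensity (hd : Differentiable ℂ G)
    (hG : ∀ z, HasSum (fun k => c k * z ^ k) (G z)) {T : Set ℝ} (hT : MeasurableSet T)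
    (hT0 : T ⊆ Set.Ioi 0)
    (hi : IntegrableOn (fun r => 2 * Real.pi * r * Real.circleAverage (fockDensity G) 0 r) T) :
    HasSum (fun k => ‖c k‖ ^ 2 *
        ∫ r in T, 2 * Real.pi * r * (r ^ (2 * k) * Real.exp (-Real.pi * r ^ 2)))
      (∫ r in T, 2 * Real.pi * r * Real.circleAverage (fockDensity G) 0 r) := by
  set F : ℕ → ℝ → ℝ := fun k r =>
    ‖c k‖ ^ 2 * (2 * Real.pi * r * (r ^ (2 * k) * Real.exp (-Real.pi * r ^ 2))) with hF
  have hFi : ∀ k, Integrable (F k) (volume.restrict T) := fun k =>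
    ((integrableOn_gaussian_moment k).mono_set hT0).const_mul _
  have hF0 : ∀ k, ∀ r ∈ T, 0 ≤ F k r := fun k r hr => by
    have : 0 < r := hT0 hr
    simp only [hF]
    positivity
  have hsum : ∀ r, HasSum (fun k => F k r)
      (2 * Real.pi * r * Real.circleAverage (fockDensity G) 0 r) := fun r => by
    rw [circleAverage_fockDensity]
    have h := (hasSum_circleAverage_norm_sq hd hG r).mul_left
      (2 * Real.pi * r * Real.exp (-Real.pi * r ^ 2))
    rw [← mul_assoc]
    refine h.congr_fun fun k => ?_
    simp only [hF]
    ring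
  have hs : Summable fun k => ∫ r in T, ‖F k r‖ := by
    have hn : ∀ k, ∫ r in T, ‖F k r‖ = ∫ r in T, F k r := fun k =>
      setIntegral_congr_fun hT fun r hr => Real.norm_of_nonneg (hF0 k r hr)
    simp_rw [hn]
    refine summable_of_sum_le (fun k => setIntegral_nonneg hT (hF0 k))
      (c := ∫ r in T, 2 * Real.pi * r * Real.circleAverage (fockDensity G) 0 r) fun u => ?_
    rw [← integral_finsetSum _ fun k _ => hFi k]
    refine setIntegral_mono_on (integrable_finsetSum _ fun k _ => hFi k) hi hT fun r hr => ?_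
    exact sum_le_hasSum _ (fun k _ => hF0 k r hr) (hsum r)
  have h := hasSum_integral_of_summable_integral_norm hFi hs
  simp_rw [(hsum _).tsum_eq] at h
  simpa only [hF, integral_const_mul] using h

/-- The monomials are orthogonal: `‖G‖² = ∑ |c_k|² k!/π^k` for `G = ∑ c_k z^k`. -/
theorem hasSum_fockNorm_sq (hm : G ∈ fockSpace)
    (hG : ∀ z, HasSum (fun k => c k * z ^ k) (G z)) :
    HasSum (fun k => ‖c k‖ ^ 2 * ((k.factorial : ℝ) / Real.pi ^ k)) (fockNorm G ^ 2) := by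
  have hc := continuous_fockDensity hm.1.continuous
  have h := hasSum_integral_circleAverage_fockDensity hm.1 hG measurableSet_Ioi subset_rfl
    (integrableOn_circleAverage hc.stronglyMeasurable hm.2)
  simp_rw [integral_gaussian_moment] at h
  rw [fockNorm_sq, integral_eq_integral_circleAverage hc.stronglyMeasurable hm.2]
  exact h

theorem hasSum_setIntegral_ball_fockDensity (hm : G ∈ fockSpace)
    (hG : ∀ z, HasSum (fun k => c k * z ^ k) (G z)) {ρ : ℝ} (hρ : 0 ≤ ρ) :
    HasSum (fun k => ‖c k‖ ^ 2 * ((k.factorial : ℝ) / Real.pi ^ k *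
        (1 - Real.exp (-(Real.pi * ρ ^ 2)) *
          ∑ j ∈ Finset.range (k + 1), (Real.pi * ρ ^ 2) ^ j / (j.factorial : ℝ))))
      (∫ z in Metric.ball 0 ρ, fockDensity G z) := by
  have hc := continuous_fockDensity hm.1.continuous
  have h := hasSum_integral_circleAverage_fockDensity hm.1 hG (T := Set.Ioo 0 ρ) measurableSet_Ioo
    Set.Ioo_subset_Ioi_self
    ((integrableOn_circleAverage hc.stronglyMeasurable hm.2).mono_set Set.Ioo_subset_Ioi_self)
  simp_rw [integral_gaussian_moment_Ioo _ hρ] at h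
  rw [setIntegral_ball_eq_integral_circleAverage hc.stronglyMeasurable hm.2.integrableOn]
  exact h

theorem integrable_fockInner {F H : ℂ → ℂ} (hF : F ∈ fockSpace) (hH : H ∈ fockSpace) :
    Integrable fun z : ℂ =>
      F z * (starRingEnd ℂ) (H z) * (Real.exp (-Real.pi * ‖z‖ ^ 2) : ℂ) := by
  have hFc := hF.1.continuous
  have hHc := hH.1.continuous
  refine (hF.2.add hH.2).mono' (by fun_prop) (Filter.Eventually.of_forall fun z => ?_)
  simp only [norm_mul, RCLike.norm_conj, Pi.add_apply, fockDensity, Complex.norm_real,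
    Real.norm_of_nonneg (Real.exp_pos _).le]
  have h1 : ‖F z‖ * ‖H z‖ ≤ ‖F z‖ ^ 2 + ‖H z‖ ^ 2 := by
    nlinarith [sq_nonneg (‖F z‖ - ‖H z‖), norm_nonneg (F z), norm_nonneg (H z)]
  rw [← add_mul]
  gcongr

theorem fockInner_pow (hm : G ∈ fockSpace)
    (hG : ∀ z, HasSum (fun k => c k * z ^ k) (G z)) (l : ℕ) :
    fockInner G (fun z => z ^ l) = c l * (((l.factorial : ℝ) / Real.pi ^ l : ℝ) : ℂ) := by
  have hGc := hm.1.continuous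
  rw [fockInner, integral_eq_integral_circleAverage
    (Continuous.stronglyMeasurable (by fun_prop)) (integrable_fockInner hm (pow_mem_fockSpace l)),
    ← integral_gaussian_moment, ← integral_complex_ofReal, ← integral_const_mul]
  refine setIntegral_congr_fun measurableSet_Ioi fun r (hr : 0 < r) => ?_
  have h : Real.circleAverage (fun z => G z * (starRingEnd ℂ) (z ^ l) *
      (Real.exp (-Real.pi * ‖z‖ ^ 2) : ℂ)) 0 r =
      (Real.exp (-Real.pi * r ^ 2) : ℂ) * (c l * (r : ℂ) ^ (2 * l)) := by
    have h1 := Real.circleAverage_fun_smul (a := (Real.exp (-Real.pi * r ^ 2) : ℂ)) (c := 0)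
      (R := r) (f := fun z : ℂ => G z * (starRingEnd ℂ) z ^ l)
    simp only [smul_eq_mul] at h1
    rw [circleAverage_mul_conj_pow hG] at h1
    rw [← h1]
    refine Real.circleAverage_congr_sphere fun z hz => ?_
    simp only [mem_sphere_iff_norm, sub_zero] at hz
    simp only [hz, sq_abs, map_pow]
    ring
  simp only [h, Complex.real_smul]
  push_cast
  ring

end Coefficients

/-! ### Expansions in the normalized monomials -/

section Monomials

variable {a : ℕ → ℂ} {G : ℂ → ℂ}

theorem hasSum_pow_of_hasSum_fockMonomial
    (ha : ∀ z, HasSum (fun k => a k * fockMonomial k z) (G z)) (z : ℂ) :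
    HasSum (fun k => a k * (Real.sqrt (Real.pi ^ k / (k.factorial : ℝ)) : ℂ) * z ^ k) (G z) := by
  simpa only [fockMonomial, ← mul_assoc] using ha z

theorem norm_mul_sqrt_sq (x : ℂ) (k : ℕ) :
    ‖x * (Real.sqrt (Real.pi ^ k / (k.factorial : ℝ)) : ℂ)‖ ^ 2 =
      ‖x‖ ^ 2 * (Real.pi ^ k / (k.factorial : ℝ)) := by
  rw [norm_mul, mul_pow, Complex.norm_real, Real.norm_of_nonneg (Real.sqrt_nonneg _),
    Real.sq_sqrt (by positivity)]

theorem pi_pow_div_factorial_mul (k : ℕ) :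
    Real.pi ^ k / (k.factorial : ℝ) * ((k.factorial : ℝ) / Real.pi ^ k) = 1 := by
  have : (k.factorial : ℝ) ≠ 0 := by positivity
  field_simp

theorem hasSum_norm_sq_fockMonomial (hm : G ∈ fockSpace)
    (ha : ∀ z, HasSum (fun k => a k * fockMonomial k z) (G z)) :
    HasSum (fun k => ‖a k‖ ^ 2) (fockNorm G ^ 2) := by
  have h := hasSum_fockNorm_sq hm (hasSum_pow_of_hasSum_fockMonomial ha)
  simpa only [norm_mul_sqrt_sq, mul_assoc, pi_pow_div_factorial_mul, mul_one] using h

theorem hasSum_setIntegral_ball_fockMonomial (hm : G ∈ fockSpace)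
    (ha : ∀ z, HasSum (fun k => a k * fockMonomial k z) (G z)) {ρ : ℝ} (hρ : 0 ≤ ρ) :
    HasSum (fun k => ‖a k‖ ^ 2 * (1 - Real.exp (-(Real.pi * ρ ^ 2)) *
          ∑ j ∈ Finset.range (k + 1), (Real.pi * ρ ^ 2) ^ j / (j.factorial : ℝ)))
      (∫ z in Metric.ball 0 ρ, fockDensity G z) := by
  have h := hasSum_setIntegral_ball_fockDensity hm (hasSum_pow_of_hasSum_fockMonomial ha) hρ
  refine h.congr_fun fun k => ?_
  rw [norm_mul_sqrt_sq, mul_assoc, ← mul_assoc (Real.pi ^ k / _), pi_pow_div_factorial_mul,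
    one_mul]

theorem hasSum_circleAverage_fockMonomial (hm : G ∈ fockSpace)
    (ha : ∀ z, HasSum (fun k => a k * fockMonomial k z) (G z)) (r : ℝ) :
    HasSum (fun k => ‖a k‖ ^ 2 * ((Real.pi * r ^ 2) ^ k / (k.factorial : ℝ)))
      (Real.circleAverage (fun z => ‖G z‖ ^ 2) 0 r) := by
  have h := hasSum_circleAverage_norm_sq hm.1 (hasSum_pow_of_hasSum_fockMonomial ha) r
  refine h.congr_fun fun k => ?_
  rw [norm_mul_sqrt_sq]
  ring

theorem exists_hasSum_fockMonomial (hd : Differentiable ℂ G) :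
    ∃ a : ℕ → ℂ, ∀ z, HasSum (fun k => a k * fockMonomial k z) (G z) := by
  refine ⟨fun k => (k.factorial : ℂ)⁻¹ * iteratedDeriv k G 0 *
    (Real.sqrt (Real.pi ^ k / (k.factorial : ℝ)) : ℂ)⁻¹, fun z => ?_⟩
  refine (Complex.hasSum_taylorSeries_of_entire hd 0 z).congr_fun fun k => ?_
  have h0 : (Real.sqrt (Real.pi ^ k / (k.factorial : ℝ)) : ℂ) ≠ 0 := by
    rw [Complex.ofReal_ne_zero]
    positivity
  simp only [fockMonomial, smul_eq_mul, sub_zero]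
  field_simp

theorem fockInner_pow_eq_zero_iff (hm : G ∈ fockSpace)
    (ha : ∀ z, HasSum (fun k => a k * fockMonomial k z) (G z)) (l : ℕ) :
    fockInner G (fun z => z ^ l) = 0 ↔ a l = 0 := by
  rw [fockInner_pow hm (hasSum_pow_of_hasSum_fockMonomial ha)]
  have h1 : Real.sqrt (Real.pi ^ l / (l.factorial : ℝ)) ≠ 0 := by positivity
  have h2 : (l.factorial : ℝ) / Real.pi ^ l ≠ 0 := by positivity
  rw [mul_eq_zero, mul_eq_zero, Complex.ofReal_eq_zero, Complex.ofReal_eq_zero]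
  tauto

/-- The reproducing kernel bound `|G(z)|² e^{-π|z|²} ≤ ‖G‖²`. -/
theorem fockDensity_le (hm : G ∈ fockSpace) (z : ℂ) : fockDensity G z ≤ fockNorm G ^ 2 := by
  obtain ⟨a, ha⟩ := exists_hasSum_fockMonomial hm.1
  have h1 := hasSum_norm_sq_fockMonomial hm ha
  have h2 : ∀ n, ‖∑ k ∈ Finset.range n, a k * fockMonomial k z‖ ^ 2 ≤
      fockNorm G ^ 2 * Real.exp (Real.pi * ‖z‖ ^ 2) := by
    intro n
    have h3 : ∀ k, ‖fockMonomial k z‖ ^ 2 = (Real.pi * ‖z‖ ^ 2) ^ k / (k.factorial : ℝ) := by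
      intro k
      rw [fockMonomial, mul_comm, norm_mul_sqrt_sq, norm_pow]
      ring
    calc ‖∑ k ∈ Finset.range n, a k * fockMonomial k z‖ ^ 2
        ≤ (∑ k ∈ Finset.range n, ‖a k‖ * ‖fockMonomial k z‖) ^ 2 := by
          gcongr
          refine (norm_sum_le _ _).trans_eq ?_
          simp_rw [norm_mul]
      _ ≤ (∑ k ∈ Finset.range n, ‖a k‖ ^ 2) * ∑ k ∈ Finset.range n, ‖fockMonomial k z‖ ^ 2 :=
          Finset.sum_mul_sq_le_sq_mul_sq _ _ _
      _ ≤ _ := by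
          gcongr
          · exact sum_le_hasSum _ (fun k _ => by positivity) h1
          · simp_rw [h3]
            exact Real.sum_le_exp_of_nonneg (by positivity) n
  have h4 : ‖G z‖ ^ 2 ≤ fockNorm G ^ 2 * Real.exp (Real.pi * ‖z‖ ^ 2) :=
    le_of_tendsto (((ha z).tendsto_sum_nat.norm).pow 2) (Filter.Eventually.of_forall h2)
  calc fockDensity G z
      ≤ fockNorm G ^ 2 * Real.exp (Real.pi * ‖z‖ ^ 2) * Real.exp (-Real.pi * ‖z‖ ^ 2) := by
        unfold fockDensity
        gcongr
    _ = fockNorm G ^ 2 := by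
        rw [mul_assoc, ← Real.exp_add]
        simp

end Monomials

/-! ### Integrals over star-shaped regions with moving boundary -/

section MovingBoundary

variable {E : Type*} [NormedAddCommGroup E] [NormedSpace ℝ E]

/-- The integral of `f` over the star-shaped region that reaches the radius `R (p, θ)` in the
direction `θ`, as a function of the parameter `p`. -/
noncomputable def starIntegral (R : E × ℝ → ℝ) (f : ℂ → ℝ) (p : E) : ℝ :=
  ∫ θ in -Real.pi..Real.pi, ∫ r in 0..R (p, θ), r * f (circleMap 0 r θ)

/-- The derivative of `starIntegral R f` at `p`: the flux of `f` through the moving boundary. -/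
noncomputable def starFlux (R : E × ℝ → ℝ) (f : ℂ → ℝ) (p : E) : E →L[ℝ] ℝ :=
  ∫ θ in -Real.pi..Real.pi, (R (p, θ) * f (circleMap 0 (R (p, θ)) θ)) •
    (fderiv ℝ R (p, θ)).comp (ContinuousLinearMap.inl ℝ E ℝ)

variable {R : E × ℝ → ℝ} {V : Set E} {f : ℂ → ℝ}

theorem continuous_of_contDiffOn_prod (hR : ContDiffOn ℝ 1 R (V ×ˢ Set.univ)) {p : E}
    (hp : p ∈ V) : Continuous fun θ : ℝ => R (p, θ) :=
  hR.continuousOn.comp_continuous (by fun_prop) fun _ => ⟨hp, Set.mem_univ _⟩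

theorem continuousOn_starFlux_integrand (hV : IsOpen V)
    (hR : ContDiffOn ℝ 1 R (V ×ˢ Set.univ)) (hf : Continuous f) :
    ContinuousOn (Function.uncurry fun (p : E) (θ : ℝ) =>
      (R (p, θ) * f (circleMap 0 (R (p, θ)) θ)) •
        (fderiv ℝ R (p, θ)).comp (ContinuousLinearMap.inl ℝ E ℝ)) (V ×ˢ Set.univ) := by
  have h1 : ContinuousOn (fun q : E × ℝ => (R q, q.2)) (V ×ˢ Set.univ) :=
    hR.continuousOn.prodMk continuousOn_snd
  have h2 : ContinuousOn (fun q : E × ℝ => f (circleMap 0 (R q) q.2)) (V ×ˢ Set.univ) :=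
    (hf.comp continuous_uncurry_circleMap).comp_continuousOn h1
  have h3 : ContinuousOn (fun q : E × ℝ => (fderiv ℝ R q).comp (ContinuousLinearMap.inl ℝ E ℝ))
      (V ×ˢ Set.univ) :=
    (hR.continuousOn_fderiv_of_isOpen (hV.prod isOpen_univ) le_rfl).clm_comp continuousOn_const
  exact (hR.continuousOn.mul h2).smul h3

theorem hasFDerivAt_starIntegral (hV : IsOpen V) (hR : ContDiffOn ℝ 1 R (V ×ˢ Set.univ))
    (hf : Continuous f) :
    (∀ p ∈ V, HasFDerivAt (starIntegral R f) (starFlux R f p) p) ∧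
      ContinuousOn (starFlux R f) V := by
  refine hasFDerivAt_intervalIntegral_of_continuousOn hV ?_
    (continuousOn_starFlux_integrand hV hR hf) ?_ _ _
  · intro p hp θ
    have h1 : HasFDerivAt R (fderiv ℝ R (p, θ)) (p, θ) :=
      ((hR.differentiableOn one_ne_zero).differentiableAt
        ((hV.prod isOpen_univ).mem_nhds ⟨hp, Set.mem_univ _⟩)).hasFDerivAt
    have h2 := HasFDerivAt.comp (f := fun e : E => (e, θ)) p h1 (hasFDerivAt_prodMk_left p θ)
    have hc : Continuous fun r : ℝ => r * f (circleMap 0 r θ) :=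
      continuous_id.mul (hf.comp (continuous_uncurry_circleMap.comp (by fun_prop :
        Continuous fun r : ℝ => (r, θ))))
    exact (hc.integral_hasStrictDerivAt 0 (R (p, θ))).hasDerivAt.comp_hasFDerivAt p h2
  · intro p hp
    refine intervalIntegral.continuous_parametric_intervalIntegral_of_continuous ?_
      (continuous_of_contDiffOn_prod hR hp)
    exact continuous_snd.mul (hf.comp (continuous_uncurry_circleMap.comp continuous_swap))

theorem starFlux_apply (hV : IsOpen V) (hR : ContDiffOn ℝ 1 R (V ×ˢ Set.univ))
    (hf : Continuous f) {p : E} (hp : p ∈ V) (v : E) :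
    starFlux R f p v = ∫ θ in -Real.pi..Real.pi,
      R (p, θ) * f (circleMap 0 (R (p, θ)) θ) * fderiv ℝ R (p, θ) (v, 0) := by
  have hc := (continuousOn_starFlux_integrand hV hR hf).comp_continuous
    (f := fun θ : ℝ => (p, θ)) (by fun_prop) fun _ => ⟨hp, Set.mem_univ _⟩
  rw [starFlux]
  refine (ContinuousLinearMap.intervalIntegral_apply (hc.intervalIntegrable _ _) v).trans ?_
  simp

end MovingBoundary

/-! ### Super-level sets near the Gaussian -/

/-- The density of `1 + ε G`. -/
noncomputable def perturbedDensity (G : ℂ → ℂ) (ε : ℝ) (z : ℂ) : ℝ :=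
  fockDensity (fun z => 1 + (ε : ℂ) * G z) z

/-- The coefficient of `ε` in the density of `1 + ε G`. -/
noncomputable def crossDensity (G : ℂ → ℂ) (z : ℂ) : ℝ :=
  2 * (G z).re * Real.exp (-Real.pi * ‖z‖ ^ 2)

/-- The density of the constant function `1`. -/
noncomputable def gaussDensity (z : ℂ) : ℝ :=
  Real.exp (-Real.pi * ‖z‖ ^ 2)

theorem perturbedDensity_eq (G : ℂ → ℂ) (ε : ℝ) (z : ℂ) :
    perturbedDensity G ε z = gaussDensity z + ε * crossDensity G z + ε ^ 2 * fockDensity G z := by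
  have h : ‖1 + (ε : ℂ) * G z‖ ^ 2 = 1 + ε * (2 * (G z).re) + ε ^ 2 * ‖G z‖ ^ 2 := by
    rw [← Complex.normSq_eq_norm_sq, ← Complex.normSq_eq_norm_sq, Complex.normSq_apply,
      Complex.normSq_apply]
    simp
    ring
  simp only [perturbedDensity, fockDensity, gaussDensity, crossDensity, h]
  ring

theorem perturbedDensity_zero (G : ℂ → ℂ) (z : ℂ) : perturbedDensity G 0 z = gaussDensity z := by
  simp [perturbedDensity_eq]

theorem contDiff_gaussDensity : ContDiff ℝ 1 gaussDensity :=
  ((contDiff_const (c := -Real.pi)).mul (contDiff_norm_sq ℝ)).exp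

section Levels

variable {G : ℂ → ℂ}

theorem contDiff_crossDensity (hd : Differentiable ℂ G) : ContDiff ℝ 1 (crossDensity G) := by
  have hG : ContDiff ℝ 1 G := (hd.contDiff (n := 1)).restrict_scalars ℝ
  exact (contDiff_const.mul (Complex.reCLM.contDiff.comp hG)).mul contDiff_gaussDensity

theorem contDiff_fockDensity (hd : Differentiable ℂ G) : ContDiff ℝ 1 (fockDensity G) := by
  have hG : ContDiff ℝ 1 G := (hd.contDiff (n := 1)).restrict_scalars ℝ
  exact (hG.norm_sq ℝ).mul contDiff_gaussDensity

theorem contDiff_uncurry_perturbedDensity (hd : Differentiable ℂ G) :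
    ContDiff ℝ 1 fun q : ℝ × ℂ => perturbedDensity G q.1 q.2 := by
  simp_rw [perturbedDensity_eq]
  have h0 := contDiff_gaussDensity
  have h1 := contDiff_crossDensity hd
  have h2 := contDiff_fockDensity hd
  exact ((h0.comp contDiff_snd).add (contDiff_fst.mul (h1.comp contDiff_snd))).add
    ((contDiff_fst.pow 2).mul (h2.comp contDiff_snd))

/-- The Euler derivative `r ∂_r` of the density of `1 + ε G`. -/
noncomputable def radialDeriv (G : ℂ → ℂ) (q : ℝ × ℂ) : ℝ :=
  fderiv ℝ (fun q : ℝ × ℂ => perturbedDensity G q.1 q.2) q (0, q.2)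

theorem continuous_radialDeriv (hd : Differentiable ℂ G) : Continuous (radialDeriv G) :=
  ((contDiff_uncurry_perturbedDensity hd).continuous_fderiv one_ne_zero).clm_apply (by fun_prop)

theorem hasDerivAt_circleMap_radius (r θ : ℝ) :
    HasDerivAt (fun r : ℝ => circleMap 0 r θ) (circleMap 0 1 θ) r := by
  have := (Complex.ofRealCLM.hasDerivAt (x := r)).mul_const (Complex.exp (θ * Complex.I))
  simpa [circleMap] using this

theorem hasDerivAt_perturbedDensity_radius (hd : Differentiable ℂ G) (ε θ : ℝ) {r : ℝ}
    (hr : r ≠ 0) :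
    HasDerivAt (fun r => perturbedDensity G ε (circleMap 0 r θ))
      (radialDeriv G (ε, circleMap 0 r θ) / r) r := by
  have h1 := ((contDiff_uncurry_perturbedDensity hd).differentiable one_ne_zero
    (ε, circleMap 0 r θ)).hasFDerivAt
  have h2 : HasDerivAt (fun r : ℝ => (ε, circleMap 0 r θ)) ((0 : ℝ), circleMap 0 1 θ) r :=
    (hasDerivAt_const r ε).prodMk (hasDerivAt_circleMap_radius r θ)
  refine (h1.comp_hasDerivAt r h2).congr_deriv ?_
  have h3 : ((0 : ℝ), circleMap 0 r θ) = r • ((0 : ℝ), circleMap 0 1 θ) := by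
    ext <;> simp [circleMap]
  rw [radialDeriv]
  simp only
  rw [h3, map_smul, smul_eq_mul, mul_div_cancel_left₀ _ hr]

theorem radialDeriv_zero (hd : Differentiable ℂ G) (z : ℂ) :
    radialDeriv G (0, z) = -(2 * Real.pi * ‖z‖ ^ 2) * Real.exp (-Real.pi * ‖z‖ ^ 2) := by
  by_cases hz : ‖z‖ = 0
  · have : z = 0 := norm_eq_zero.1 hz
    rw [radialDeriv, this]
    simp only
    rw [show ((0 : ℝ), (0 : ℂ)) = 0 from rfl, map_zero]
    simp
  · have hzc : circleMap 0 ‖z‖ z.arg = z := by simp [circleMap]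
    have h1 := hasDerivAt_perturbedDensity_radius hd 0 z.arg hz
    simp only [perturbedDensity_zero, gaussDensity, norm_circleMap_zero, sq_abs, hzc] at h1
    have h2 : HasDerivAt (fun r : ℝ => Real.exp (-Real.pi * r ^ 2))
        (Real.exp (-Real.pi * ‖z‖ ^ 2) * (-Real.pi * (2 * ‖z‖))) ‖z‖ := by
      refine (((hasDerivAt_pow 2 ‖z‖).const_mul (-Real.pi)).exp).congr_deriv ?_
      norm_num
    have h3 := h1.unique h2
    rw [div_eq_iff hz] at h3
    rw [h3]
    ring

/-- The pair `p = (ε, t)` is a regular level between the radii `r₁ < r₂`: the super-level set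
`{u > t}` of the density `u` of `1 + ε G` contains the closed disc of radius `r₁`, lies in the open
disc of radius `r₂`, and `u` strictly decreases along the rays in between. -/
structure RegularLevel (G : ℂ → ℂ) (r₁ r₂ : ℝ) (p : ℝ × ℝ) : Prop where
  pos : 0 < p.2
  inner : ∀ z : ℂ, ‖z‖ ≤ r₁ → p.2 < perturbedDensity G p.1 z
  outer : ∀ z : ℂ, r₂ ≤ ‖z‖ → perturbedDensity G p.1 z < p.2
  decreasing : ∀ z : ℂ, r₁ ≤ ‖z‖ → ‖z‖ ≤ r₂ → radialDeriv G (p.1, z) < 0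

/-- Outside the disc of radius `r` the densities are small, uniformly for small `ε`. -/
theorem perturbedDensity_le (hm : G ∈ fockSpace) (ε : ℝ) {r : ℝ} {z : ℂ} (hr : 0 ≤ r)
    (hz : r ≤ ‖z‖) :
    perturbedDensity G ε z ≤ (Real.exp (-Real.pi * r ^ 2 / 2) + |ε| * fockNorm G) ^ 2 := by
  have h1 : ‖G z‖ * Real.exp (-Real.pi * ‖z‖ ^ 2 / 2) ≤ fockNorm G := by
    refine abs_le_of_sq_le_sq' ?_ (Real.sqrt_nonneg _) |>.2
    refine le_trans (le_of_eq ?_) (fockDensity_le hm z)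
    rw [fockDensity, mul_pow, ← Real.exp_nat_mul]
    congr 2
    push_cast
    ring
  have h2 : perturbedDensity G ε z =
      (‖1 + (ε : ℂ) * G z‖ * Real.exp (-Real.pi * ‖z‖ ^ 2 / 2)) ^ 2 := by
    rw [perturbedDensity, fockDensity, mul_pow, ← Real.exp_nat_mul]
    congr 2
    push_cast
    ring
  rw [h2]
  gcongr
  have hπ := Real.pi_pos
  have h3 : Real.exp (-Real.pi * ‖z‖ ^ 2 / 2) ≤ Real.exp (-Real.pi * r ^ 2 / 2) := by
    apply Real.exp_le_exp.2
    have : r ^ 2 ≤ ‖z‖ ^ 2 := by gcongr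
    nlinarith
  calc ‖1 + (ε : ℂ) * G z‖ * Real.exp (-Real.pi * ‖z‖ ^ 2 / 2)
      ≤ (1 + |ε| * ‖G z‖) * Real.exp (-Real.pi * ‖z‖ ^ 2 / 2) := by
        gcongr
        refine (norm_add_le _ _).trans_eq ?_
        simp
    _ = Real.exp (-Real.pi * ‖z‖ ^ 2 / 2) +
        |ε| * (‖G z‖ * Real.exp (-Real.pi * ‖z‖ ^ 2 / 2)) := by ring
    _ ≤ _ := by gcongr

theorem eventually_regularLevel (hm : G ∈ fockSpace) {r₁ r₀ r₂ : ℝ} (h₁ : 0 < r₁) (h₁₀ : r₁ < r₀)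
    (h₀₂ : r₀ < r₂) :
    ∀ᶠ p in nhds ((0 : ℝ), Real.exp (-(Real.pi * r₀ ^ 2))), RegularLevel G r₁ r₂ p := by
  have hπ := Real.pi_pos
  have hcont : Continuous fun q : ℝ × ℂ => perturbedDensity G q.1 q.2 :=
    (contDiff_uncurry_perturbedDensity hm.1).continuous
  have e1 : ∀ᶠ p in nhds ((0 : ℝ), Real.exp (-(Real.pi * r₀ ^ 2))), 0 < p.2 :=
    continuousAt_snd.eventually_const_lt (Real.exp_pos _)
  have e2 : ∀ᶠ p in nhds ((0 : ℝ), Real.exp (-(Real.pi * r₀ ^ 2))),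
      ∀ z ∈ Metric.closedBall (0 : ℂ) r₁, p.2 < perturbedDensity G p.1 z := by
    refine (isCompact_closedBall _ _).eventually_forall_of_forall_eventually fun z hz => ?_
    have hpair : Continuous fun q : (ℝ × ℝ) × ℂ => (q.1.1, q.2) := by fun_prop
    have hc : Continuous fun q : (ℝ × ℝ) × ℂ => perturbedDensity G q.1.1 q.2 := by
      have h := hcont.comp hpair
      exact h
    have hc' : Continuous fun q : (ℝ × ℝ) × ℂ => q.1.2 := by fun_prop
    refine hc'.continuousAt.eventually_lt hc.continuousAt ?_
    simp only [perturbedDensity_zero, gaussDensity]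
    apply Real.exp_lt_exp.2
    rw [mem_closedBall_zero_iff] at hz
    have : ‖z‖ ^ 2 < r₀ ^ 2 := by
      have := norm_nonneg z
      gcongr
      linarith
    nlinarith
  have e3 : ∀ᶠ p in nhds ((0 : ℝ), Real.exp (-(Real.pi * r₀ ^ 2))),
      ∀ z ∈ Metric.closedBall (0 : ℂ) r₂ ∩ {z | r₁ ≤ ‖z‖}, radialDeriv G (p.1, z) < 0 := by
    refine ((isCompact_closedBall _ _).inter_right
      (isClosed_le continuous_const continuous_norm)).eventually_forall_of_forall_eventually
      fun z hz => ?_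
    have hc : Continuous fun q : (ℝ × ℝ) × ℂ => radialDeriv G (q.1.1, q.2) :=
      (continuous_radialDeriv hm.1).comp
        (by fun_prop : Continuous fun q : (ℝ × ℝ) × ℂ => (q.1.1, q.2))
    refine hc.continuousAt.eventually_lt continuousAt_const ?_
    simp only [radialDeriv_zero hm.1]
    have hz1 : 0 < ‖z‖ := h₁.trans_le hz.2
    have : 0 < 2 * Real.pi * ‖z‖ ^ 2 := by positivity
    nlinarith [Real.exp_pos (-Real.pi * ‖z‖ ^ 2)]
  have e4 : ∀ᶠ p in nhds ((0 : ℝ), Real.exp (-(Real.pi * r₀ ^ 2))),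
      (Real.exp (-Real.pi * r₂ ^ 2 / 2) + |p.1| * fockNorm G) ^ 2 < p.2 := by
    refine ContinuousAt.eventually_lt (by fun_prop) (by fun_prop) ?_
    simp only [abs_zero, zero_mul, add_zero, ← Real.exp_nat_mul]
    apply Real.exp_lt_exp.2
    push_cast
    have : r₀ ^ 2 < r₂ ^ 2 := by gcongr; linarith
    nlinarith
  filter_upwards [e1, e2, e3, e4] with p h1 h2 h3 h4
  exact ⟨h1, fun z hz => h2 z (by simpa using hz),
    fun z hz => (perturbedDensity_le hm p.1 (by linarith) hz).trans_lt h4,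
    fun z hz1 hz2 => h3 z ⟨by simpa using hz2, hz1⟩⟩

/-- The radius reached by the super-level set `{u > t}` of the density `u` of `1 + ε G` in the
direction `θ`, as a function of `((ε, t), θ)`. -/
noncomputable def levelRadius (G : ℂ → ℂ) (q : (ℝ × ℝ) × ℝ) : ℝ :=
  sSup {r : ℝ | 0 ≤ r ∧ q.1.2 < perturbedDensity G q.1.1 (circleMap 0 r q.2)}

theorem RegularLevel.exists_radius (hd : Differentiable ℂ G) {r₁ r₂ : ℝ} (h₁ : 0 < r₁)
    (h₁₂ : r₁ < r₂) {p : ℝ × ℝ} (hp : RegularLevel G r₁ r₂ p) (θ : ℝ) :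
    ∃ R ∈ Set.Ioo r₁ r₂, perturbedDensity G p.1 (circleMap 0 R θ) = p.2 ∧
      (∀ r, 0 ≤ r → (p.2 < perturbedDensity G p.1 (circleMap 0 r θ) ↔ r < R)) ∧
      ∀ r ∈ Set.Ioo r₁ r₂, perturbedDensity G p.1 (circleMap 0 r θ) = p.2 → r = R := by
  set U : ℝ → ℝ := fun r => perturbedDensity G p.1 (circleMap 0 r θ) with hU
  have hderiv : ∀ r, r ≠ 0 → HasDerivAt U (radialDeriv G (p.1, circleMap 0 r θ) / r) r :=
    fun r hr => hasDerivAt_perturbedDensity_radius hd p.1 θ hr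
  have hcont : ContinuousOn U (Set.Icc r₁ r₂) := fun r hr =>
    (hderiv r (h₁.trans_le hr.1).ne').continuousAt.continuousWithinAt
  have hn : ∀ r, 0 ≤ r → ‖circleMap 0 r θ‖ = r := fun r hr => by
    rw [norm_circleMap_zero, abs_of_nonneg hr]
  have hanti : StrictAntiOn U (Set.Icc r₁ r₂) := by
    refine strictAntiOn_of_deriv_neg (convex_Icc _ _) hcont fun r hr => ?_
    rw [interior_Icc] at hr
    have hr0 : 0 < r := h₁.trans hr.1
    rw [(hderiv r hr0.ne').deriv]
    refine div_neg_of_neg_of_pos (hp.decreasing _ ?_ ?_) hr0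
    · rw [hn r hr0.le]; exact hr.1.le
    · rw [hn r hr0.le]; exact hr.2.le
  have hU1 : p.2 < U r₁ := hp.inner _ (hn r₁ h₁.le).le
  have hU2 : U r₂ < p.2 := hp.outer _ (hn r₂ (h₁.trans h₁₂).le).ge
  obtain ⟨R, hR, hRU⟩ := intermediate_value_Ioo' h₁₂.le hcont ⟨hU2, hU1⟩
  refine ⟨R, hR, hRU, fun r hr => ?_, fun r hr hrU =>
    hanti.injOn (Set.Ioo_subset_Icc_self hr) (Set.Ioo_subset_Icc_self hR) (hrU.trans hRU.symm)⟩
  rcases le_total r r₁ with h | h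
  · exact ⟨fun _ => h.trans_lt hR.1, fun _ => hp.inner _ ((hn r hr).trans_le h)⟩
  rcases le_total r₂ r with h' | h'
  · exact ⟨fun h3 => absurd h3 (hp.outer _ (h'.trans (hn r hr).ge)).le.not_gt,
      fun h3 => absurd h3 (hR.2.trans_le h').le.not_gt⟩
  · rw [← hRU]
    exact hanti.lt_iff_gt (Set.Ioo_subset_Icc_self hR) ⟨h, h'⟩

theorem RegularLevel.levelRadius_spec (hd : Differentiable ℂ G) {r₁ r₂ : ℝ} (h₁ : 0 < r₁)
    (h₁₂ : r₁ < r₂) {p : ℝ × ℝ} (hp : RegularLevel G r₁ r₂ p) (θ : ℝ) :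
    levelRadius G (p, θ) ∈ Set.Ioo r₁ r₂ ∧
      perturbedDensity G p.1 (circleMap 0 (levelRadius G (p, θ)) θ) = p.2 ∧
      (∀ r, 0 ≤ r →
        (p.2 < perturbedDensity G p.1 (circleMap 0 r θ) ↔ r < levelRadius G (p, θ))) ∧
      ∀ r ∈ Set.Ioo r₁ r₂, perturbedDensity G p.1 (circleMap 0 r θ) = p.2 →
        r = levelRadius G (p, θ) := by
  obtain ⟨R, hR, hRU, hlt, huniq⟩ := hp.exists_radius hd h₁ h₁₂ θ
  have h : levelRadius G (p, θ) = R := by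
    have : {r : ℝ | 0 ≤ r ∧ p.2 < perturbedDensity G p.1 (circleMap 0 r θ)} = Set.Ico 0 R := by
      ext r
      exact and_congr_right fun hr => hlt r hr
    rw [levelRadius, this, csSup_Ico (h₁.trans hR.1)]
  rw [h]
  exact ⟨hR, hRU, hlt, huniq⟩

/-- The boundary radius is `C¹` because the density has non-zero radial derivative there. -/
theorem contDiffOn_levelRadius (hd : Differentiable ℂ G) {r₁ r₂ : ℝ} (h₁ : 0 < r₁)
    (h₁₂ : r₁ < r₂) {V : Set (ℝ × ℝ)} (hV : IsOpen V) (hreg : ∀ p ∈ V, RegularLevel G r₁ r₂ p) :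
    ContDiffOn ℝ 1 (levelRadius G) (V ×ˢ Set.univ) := by
  have hspec := fun (q : (ℝ × ℝ) × ℝ) (hq : q ∈ V ×ˢ (Set.univ : Set ℝ)) =>
    (hreg q.1 hq.1).levelRadius_spec hd h₁ h₁₂ q.2
  have hc : ContDiff ℝ 1 fun x : ((ℝ × ℝ) × ℝ) × ℝ =>
      perturbedDensity G x.1.1.1 (circleMap 0 x.2 x.1.2) - x.1.1.2 := by
    have h2 : ContDiff ℝ 1 fun x : ((ℝ × ℝ) × ℝ) × ℝ => circleMap 0 x.2 x.1.2 :=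
      contDiff_uncurry_circleMap.comp (contDiff_snd.prodMk (contDiff_snd.comp contDiff_fst))
    have h3 : ContDiff ℝ 1 fun x : ((ℝ × ℝ) × ℝ) × ℝ => x.1.1 :=
      contDiff_fst.comp contDiff_fst
    exact ((contDiff_uncurry_perturbedDensity hd).comp
      ((contDiff_fst.comp h3).prodMk h2)).sub (contDiff_snd.comp h3)
  refine contDiffOn_of_unique_zero (f := fun x : ((ℝ × ℝ) × ℝ) × ℝ =>
    perturbedDensity G x.1.1.1 (circleMap 0 x.2 x.1.2) - x.1.1.2) (hV.prod isOpen_univ)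
    (fun q hq => (hspec q hq).1) (fun q _ => hc.contDiffAt) ?_ ?_ ?_
  · intro q hq
    have hR := (hspec q hq).1
    have hR0 : 0 < levelRadius G q := h₁.trans hR.1
    have hn : ‖circleMap 0 (levelRadius G q) q.2‖ = levelRadius G q := by
      rw [norm_circleMap_zero, abs_of_pos hR0]
    refine ⟨_, ?_, (hasDerivAt_perturbedDensity_radius hd q.1.1 q.2 hR0.ne').sub_const q.1.2⟩
    exact (div_neg_of_neg_of_pos ((hreg q.1 hq.1).decreasing _ (by rw [hn]; exact hR.1.le)
      (by rw [hn]; exact hR.2.le)) hR0).ne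
  · intro q hq
    exact sub_eq_zero.2 (hspec q hq).2.1
  · intro q hq r hr h0
    exact (hspec q hq).2.2.2 r hr (sub_eq_zero.1 h0)

end Levels

section Superlevel

variable {G : ℂ → ℂ} {r₁ r₂ : ℝ} {p : ℝ × ℝ}

/-- The super-level set `{u > t}` of the density `u` of `1 + ε G`, for `p = (ε, t)`. -/
def superlevel (G : ℂ → ℂ) (p : ℝ × ℝ) : Set ℂ :=
  {z | p.2 < perturbedDensity G p.1 z}

theorem continuous_perturbedDensity (hd : Differentiable ℂ G) (ε : ℝ) :
    Continuous (perturbedDensity G ε) :=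
  continuous_fockDensity (by have := hd.continuous; fun_prop)

theorem isOpen_superlevel (hd : Differentiable ℂ G) (p : ℝ × ℝ) : IsOpen (superlevel G p) :=
  isOpen_lt continuous_const (continuous_perturbedDensity hd p.1)

theorem RegularLevel.superlevel_subset (hp : RegularLevel G r₁ r₂ p) :
    superlevel G p ⊆ Metric.closedBall 0 r₂ := by
  intro z (hz : p.2 < perturbedDensity G p.1 z)
  rw [mem_closedBall_zero_iff]
  by_contra! h
  exact (hp.outer z h.le).not_gt hz

theorem RegularLevel.integrableOn_superlevel (hp : RegularLevel G r₁ r₂ p) {f : ℂ → ℝ}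
    (hf : Continuous f) : IntegrableOn f (superlevel G p) :=
  (hf.continuousOn.integrableOn_compact (isCompact_closedBall 0 r₂)).mono_set hp.superlevel_subset

theorem RegularLevel.volume_superlevel_ne_top (hp : RegularLevel G r₁ r₂ p) :
    volume (superlevel G p) ≠ ⊤ :=
  ((measure_mono hp.superlevel_subset).trans_lt (isCompact_closedBall 0 r₂).measure_lt_top).ne

theorem RegularLevel.setIntegral_superlevel (hd : Differentiable ℂ G) (h₁ : 0 < r₁)
    (h₁₂ : r₁ < r₂) (hp : RegularLevel G r₁ r₂ p) {f : ℂ → ℝ} (hf : Continuous f) :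
    ∫ z in superlevel G p, f z = starIntegral (levelRadius G) f p := by
  have hspec := fun θ => hp.levelRadius_spec hd h₁ h₁₂ θ
  refine setIntegral_eq_integral_of_star (isOpen_superlevel hd p).measurableSet
    (fun θ => (h₁.trans (hspec θ).1.1).le) (fun θ r hr => ?_) hf.stronglyMeasurable
    (hp.integrableOn_superlevel hf)
  exact (hspec θ).2.2.1 r hr.le

theorem RegularLevel.volume_superlevel (hd : Differentiable ℂ G) (h₁ : 0 < r₁)
    (h₁₂ : r₁ < r₂) (hp : RegularLevel G r₁ r₂ p) :
    volume (superlevel G p) =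
      ENNReal.ofReal (starIntegral (levelRadius G) (fun _ => 1) p) := by
  rw [← hp.setIntegral_superlevel hd h₁ h₁₂ continuous_const, setIntegral_const, smul_eq_mul,
    mul_one, measureReal_def, ENNReal.ofReal_toReal hp.volume_superlevel_ne_top]

/-- At a regular level the distribution function is strictly decreasing, so that the decreasing
rearrangement takes the value `t` at `|{u > t}|`. -/
theorem RegularLevel.fockRearrangement_eq (hd : Differentiable ℂ G) (h₁ : 0 < r₁)
    (h₁₂ : r₁ < r₂) (hp : RegularLevel G r₁ r₂ p) {s : ℝ}
    (hs : volume (superlevel G p) = ENNReal.ofReal s) :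
    fockRearrangement (fun z => 1 + (p.1 : ℂ) * G z) s = p.2 := by
  have hset : {t : ℝ | 0 ≤ t ∧ ENNReal.ofReal s <
      fockDistribution (fun z => 1 + (p.1 : ℂ) * G z) t} = Set.Ico 0 p.2 := by
    ext t
    refine and_congr_right fun _ => ?_
    rw [← hs]
    constructor
    · intro h
      by_contra! ht
      refine absurd h (not_lt.2 (measure_mono fun z (hz : t < _) => ?_))
      exact lt_of_le_of_lt ht hz
    · intro ht
      obtain ⟨hR, hRU, hlt, huniq⟩ := hp.levelRadius_spec hd h₁ h₁₂ 0
      have hc : Continuous fun r : ℝ => perturbedDensity G p.1 (circleMap 0 r 0) :=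
        (continuous_perturbedDensity hd p.1).comp (continuous_uncurry_circleMap.comp
          (by fun_prop : Continuous fun r : ℝ => (r, (0 : ℝ))))
      -- Just outside the level curve the density lies strictly between `t` and `p.2`.
      have hev : ∀ᶠ r in nhds (levelRadius G (p, 0)),
          t < perturbedDensity G p.1 (circleMap 0 r 0) ∧ r ∈ Set.Ioo r₁ r₂ :=
        (hc.continuousAt.eventually_const_lt (by simpa only [hRU] using ht)).and
          (isOpen_Ioo.mem_nhds hR)
      obtain ⟨r, ⟨hrt, hr12⟩, hr⟩ := ((hev.filter_mono nhdsWithin_le_nhds).and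
        (self_mem_nhdsWithin (s := Set.Ioi (levelRadius G (p, 0))))).exists
      have hr0 : 0 ≤ r := (h₁.trans hr12.1).le
      have hlt' : perturbedDensity G p.1 (circleMap 0 r 0) < p.2 := by
        refine lt_of_le_of_ne ?_ fun h => (huniq r hr12 h).not_gt hr
        by_contra! h
        exact (((hlt r hr0).1 h).trans hr).false
      set A : Set ℂ := {z | t < perturbedDensity G p.1 z ∧ perturbedDensity G p.1 z < p.2}
      have hA : IsOpen A :=
        (isOpen_lt continuous_const (continuous_perturbedDensity hd p.1)).inter
          (isOpen_lt (continuous_perturbedDensity hd p.1) continuous_const)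
      have hApos : 0 < volume A := hA.measure_pos volume ⟨_, hrt, hlt'⟩
      have hdisj : Disjoint (superlevel G p) A :=
        Set.disjoint_left.2 fun z (hz : p.2 < _) hzA => (hz.trans hzA.2).false
      calc volume (superlevel G p) < volume (superlevel G p) + volume A :=
            ENNReal.lt_add_right hp.volume_superlevel_ne_top hApos.ne'
        _ = volume (superlevel G p ∪ A) := (measure_union hdisj hA.measurableSet).symm
        _ ≤ _ := measure_mono (Set.union_subset (fun z (hz : p.2 < _) => ht.trans hz)
            fun z hz => hz.1)
  rw [fockRearrangement, hset, csSup_Ico hp.pos]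

/-- The concentration functional, split along `u = f₀ + ε f₁ + ε² f₂`. -/
theorem RegularLevel.fockConcentration_eq (hd : Differentiable ℂ G) (h₁ : 0 < r₁)
    (h₁₂ : r₁ < r₂) (hp : RegularLevel G r₁ r₂ p) {s : ℝ}
    (hs : starIntegral (levelRadius G) (fun _ => 1) p = s) :
    fockConcentration (fun z => 1 + (p.1 : ℂ) * G z) s =
      starIntegral (levelRadius G) gaussDensity p +
        p.1 * starIntegral (levelRadius G) (crossDensity G) p +
        p.1 ^ 2 * starIntegral (levelRadius G) (fockDensity G) p := by
  have h0 := contDiff_gaussDensity.continuous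
  have h1' := (contDiff_crossDensity hd).continuous
  have h2 := (contDiff_fockDensity hd).continuous
  have i1 : IntegrableOn (fun z => p.1 * crossDensity G z) (superlevel G p) :=
    (hp.integrableOn_superlevel h1').const_mul _
  have i2 : IntegrableOn (fun z => p.1 ^ 2 * fockDensity G z) (superlevel G p) :=
    (hp.integrableOn_superlevel h2).const_mul _
  have i01 : IntegrableOn (fun z => gaussDensity z + p.1 * crossDensity G z) (superlevel G p) :=
    (hp.integrableOn_superlevel h0).add i1
  rw [fockConcentration, hp.fockRearrangement_eq hd h₁ h₁₂
    (by rw [hp.volume_superlevel hd h₁ h₁₂, hs]),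
    ← hp.setIntegral_superlevel hd h₁ h₁₂ h0, ← hp.setIntegral_superlevel hd h₁ h₁₂ h1',
    ← hp.setIntegral_superlevel hd h₁ h₁₂ h2, ← integral_const_mul, ← integral_const_mul,
    ← integral_add (hp.integrableOn_superlevel h0) i1, ← integral_add i01 i2]
  exact integral_congr_ae (Filter.Eventually.of_forall fun z => perturbedDensity_eq G p.1 z)

end Superlevel

/-! ### The boundary flux at the Gaussian -/

section Flux

variable {G : ℂ → ℂ} {r₁ r₀ r₂ : ℝ}

theorem levelRadius_base (hd : Differentiable ℂ G) (h₁ : 0 < r₁) (h₁₀ : r₁ < r₀) (h₀₂ : r₀ < r₂)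
    (hp : RegularLevel G r₁ r₂ (0, Real.exp (-(Real.pi * r₀ ^ 2)))) (θ : ℝ) :
    levelRadius G ((0, Real.exp (-(Real.pi * r₀ ^ 2))), θ) = r₀ := by
  refine ((hp.levelRadius_spec hd h₁ (h₁₀.trans h₀₂) θ).2.2.2 r₀ ⟨h₁₀, h₀₂⟩ ?_).symm
  simp [perturbedDensity_zero, gaussDensity]

/-- The first variation of the level radius, from differentiating `u(ε, R e^{iθ}) = t`. -/
theorem fderiv_levelRadius_base (hd : Differentiable ℂ G) (h₁ : 0 < r₁) (h₁₀ : r₁ < r₀)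
    (h₀₂ : r₀ < r₂) {V : Set (ℝ × ℝ)} (hV : IsOpen V) (hreg : ∀ p ∈ V, RegularLevel G r₁ r₂ p)
    (hp : (0, Real.exp (-(Real.pi * r₀ ^ 2))) ∈ V) (θ : ℝ) (v : ℝ × ℝ) :
    r₀ * fderiv ℝ (levelRadius G) ((0, Real.exp (-(Real.pi * r₀ ^ 2))), θ) (v, 0) =
      Real.exp (Real.pi * r₀ ^ 2) / (2 * Real.pi) *
        (crossDensity G (circleMap 0 r₀ θ) * v.1 - v.2) := by
  set p₀ : ℝ × ℝ := (0, Real.exp (-(Real.pi * r₀ ^ 2))) with hp₀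
  have hr₀ : 0 < r₀ := h₁.trans h₁₀
  have hbase : levelRadius G (p₀, θ) = r₀ := levelRadius_base hd h₁ h₁₀ h₀₂ (hreg _ hp) θ
  set x := fderiv ℝ (levelRadius G) (p₀, θ) (v, 0) with hx
  have hline : HasDerivAt (fun τ : ℝ => (p₀ + τ • v, θ)) (v, (0 : ℝ)) 0 := by
    have h := ((hasDerivAt_id (0 : ℝ)).smul_const v).const_add p₀
    simpa using h.prodMk (hasDerivAt_const (0 : ℝ) θ)
  have hRd : HasFDerivAt (levelRadius G) (fderiv ℝ (levelRadius G) (p₀, θ))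
      (p₀ + (0 : ℝ) • v, θ) := by
    rw [zero_smul, add_zero]
    exact (((contDiffOn_levelRadius hd h₁ (h₁₀.trans h₀₂) hV hreg).differentiableOn
      one_ne_zero).differentiableAt
        ((hV.prod isOpen_univ).mem_nhds ⟨hp, Set.mem_univ _⟩)).hasFDerivAt
  have hρ : HasDerivAt (fun τ : ℝ => levelRadius G (p₀ + τ • v, θ)) x 0 :=
    HasFDerivAt.comp_hasDerivAt (f := fun τ : ℝ => (p₀ + τ • v, θ)) (0 : ℝ) hRd hline
  have hρ0 : levelRadius G (p₀ + (0 : ℝ) • v, θ) = r₀ := by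
    rw [zero_smul, add_zero, hbase]
  have hz : HasDerivAt (fun τ : ℝ => circleMap 0 (levelRadius G (p₀ + τ • v, θ)) θ)
      (x • circleMap 0 1 θ) 0 :=
    HasDerivAt.scomp (0 : ℝ) (hasDerivAt_circleMap_radius _ θ) hρ
  have hgauss : HasDerivAt
      (fun τ : ℝ => gaussDensity (circleMap 0 (levelRadius G (p₀ + τ • v, θ)) θ))
      (Real.exp (-(Real.pi * r₀ ^ 2)) * (-Real.pi * (2 * r₀ * x))) 0 := by
    simp only [gaussDensity, norm_circleMap_zero, sq_abs]
    refine (((hρ.pow 2).const_mul (-Real.pi)).exp).congr_deriv ?_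
    simp [hbase]
  have hcross := HasFDerivAt.comp_hasDerivAt (0 : ℝ)
    ((contDiff_crossDensity hd).differentiable one_ne_zero _).hasFDerivAt hz
  have hdens := HasFDerivAt.comp_hasDerivAt (0 : ℝ)
    ((contDiff_fockDensity hd).differentiable one_ne_zero _).hasFDerivAt hz
  have hlin : HasDerivAt (fun τ : ℝ => τ * v.1) v.1 0 := by
    simpa using (hasDerivAt_id (0 : ℝ)).mul_const v.1
  have hall := (hgauss.add (hlin.mul hcross)).add ((hlin.pow 2).mul hdens)
  have hrhs : HasDerivAt (fun τ : ℝ => Real.exp (-(Real.pi * r₀ ^ 2)) + τ * v.2) v.2 0 := by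
    simpa using ((hasDerivAt_id (0 : ℝ)).mul_const v.2).const_add
      (Real.exp (-(Real.pi * r₀ ^ 2)))
  have hmem : ∀ᶠ τ : ℝ in nhds 0, p₀ + τ • v ∈ V := by
    have hc : Continuous fun τ : ℝ => p₀ + τ • v := by fun_prop
    exact hc.continuousAt.eventually_mem (hV.mem_nhds (by simpa using hp))
  have heq := hrhs.congr_of_eventuallyEq (f := _) (hmem.mono fun τ hτ => ?_) |>.unique hall
  rotate_left
  · have h := ((hreg _ hτ).levelRadius_spec hd h₁ (h₁₀.trans h₀₂) θ).2.1
    rw [perturbedDensity_eq] at h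
    simpa [hp₀] using h
  simp only [hρ0, zero_mul, add_zero, Function.comp] at heq
  have hexp : Real.exp (Real.pi * r₀ ^ 2) * Real.exp (-(Real.pi * r₀ ^ 2)) = 1 := by
    rw [← Real.exp_add, add_neg_cancel, Real.exp_zero]
  have hπ := Real.pi_ne_zero
  have heq' : v.2 = Real.exp (-(Real.pi * r₀ ^ 2)) * (-Real.pi * (2 * r₀ * x)) +
      v.1 * crossDensity G (circleMap 0 r₀ θ) := by
    simpa using heq
  have hmul : Real.exp (Real.pi * r₀ ^ 2) / (2 * Real.pi) *
      (crossDensity G (circleMap 0 r₀ θ) * v.1 - v.2) =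
      Real.exp (Real.pi * r₀ ^ 2) * Real.exp (-(Real.pi * r₀ ^ 2)) * (r₀ * x) := by
    rw [heq']
    field_simp
    ring
  rw [hmul, hexp, one_mul]

/-- The flux through the circle `|z| = r₀`, along which `r₀ ∂R` is known explicitly. -/
theorem starFlux_base (hd : Differentiable ℂ G) (h₁ : 0 < r₁) (h₁₀ : r₁ < r₀)
    (h₀₂ : r₀ < r₂) {V : Set (ℝ × ℝ)} (hV : IsOpen V) (hreg : ∀ p ∈ V, RegularLevel G r₁ r₂ p)
    (hp : (0, Real.exp (-(Real.pi * r₀ ^ 2))) ∈ V) {f : ℂ → ℝ} (hf : Continuous f) (v : ℝ × ℝ) :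
    starFlux (levelRadius G) f (0, Real.exp (-(Real.pi * r₀ ^ 2))) v =
      Real.exp (Real.pi * r₀ ^ 2) *
        (v.1 * Real.circleAverage (fun z => f z * crossDensity G z) 0 r₀ -
          v.2 * Real.circleAverage f 0 r₀) := by
  have hc := (contDiff_crossDensity hd).continuous
  rw [starFlux_apply hV (contDiffOn_levelRadius hd h₁ (h₁₀.trans h₀₂) hV hreg) hf hp]
  simp_rw [levelRadius_base hd h₁ h₁₀ h₀₂ (hreg _ hp)]
  have h1 : ∀ θ : ℝ, r₀ * f (circleMap 0 r₀ θ) *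
      fderiv ℝ (levelRadius G) ((0, Real.exp (-(Real.pi * r₀ ^ 2))), θ) (v, 0) =
      Real.exp (Real.pi * r₀ ^ 2) / (2 * Real.pi) * (v.1 *
        (f (circleMap 0 r₀ θ) * crossDensity G (circleMap 0 r₀ θ)) -
          v.2 * f (circleMap 0 r₀ θ)) := by
    intro θ
    rw [mul_right_comm, fderiv_levelRadius_base hd h₁ h₁₀ h₀₂ hV hreg hp]
    ring
  have hcm := continuous_circleMap 0 r₀
  simp_rw [h1]
  rw [intervalIntegral.integral_const_mul, intervalIntegral.integral_sub
    (Continuous.intervalIntegrable (by fun_prop) _ _)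
    (Continuous.intervalIntegrable (by fun_prop) _ _), intervalIntegral.integral_const_mul,
    intervalIntegral.integral_const_mul, intervalIntegral_circleMap_eq_circleAverage f,
    intervalIntegral_circleMap_eq_circleAverage fun z => f z * crossDensity G z]
  simp only [smul_eq_mul]
  field_simp

theorem circleAverage_crossDensity (hd : Differentiable ℂ G) (h0 : G 0 = 0) (r : ℝ) :
    Real.circleAverage (crossDensity G) 0 r = 0 := by
  have h := Real.circleAverage_fun_smul (a := 2 * Real.exp (-Real.pi * r ^ 2)) (c := 0) (R := r)
    (f := fun z : ℂ => (G z).re)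
  rw [circleAverage_re hd.continuous, circleAverage_of_entire hd, h0, Complex.zero_re,
    smul_zero] at h
  rw [← h]
  refine Real.circleAverage_congr_sphere fun z hz => ?_
  simp only [mem_sphere_iff_norm, sub_zero] at hz
  simp only [crossDensity, hz, sq_abs, smul_eq_mul]
  ring

/-- `(Re G)² = (|G|² + Re G²)/2`, and `Re G²` has mean zero when `G` vanishes at the centre. -/
theorem circleAverage_crossDensity_sq (hd : Differentiable ℂ G) (h0 : G 0 = 0) (r : ℝ) :
    Real.circleAverage (fun z => crossDensity G z * crossDensity G z) 0 r =
      2 * Real.exp (-(Real.pi * r ^ 2)) ^ 2 * Real.circleAverage (fun z => ‖G z‖ ^ 2) 0 r := by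
  have hGc := hd.continuous
  have h1 : Real.circleAverage (fun z => crossDensity G z * crossDensity G z) 0 r =
      Real.circleAverage (fun z => (2 * Real.exp (-(Real.pi * r ^ 2)) ^ 2) •
        (‖G z‖ ^ 2 + (G z ^ 2).re)) 0 r := by
    refine Real.circleAverage_congr_sphere fun z hz => ?_
    simp only [mem_sphere_iff_norm, sub_zero] at hz
    have h2 : ‖G z‖ ^ 2 = (G z).re * (G z).re + (G z).im * (G z).im := by
      rw [← Complex.normSq_eq_norm_sq, Complex.normSq_apply]
    simp only [crossDensity, hz, sq_abs, smul_eq_mul, h2, sq (G z), Complex.mul_re, neg_mul]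
    ring
  have h3 : Real.circleAverage (fun z => (G z ^ 2).re) 0 r = 0 := by
    rw [circleAverage_re (h := fun z => G z ^ 2) (by fun_prop),
      circleAverage_of_entire (G := fun z => G z ^ 2) (by fun_prop), h0]
    simp
  have i1 : CircleIntegrable (fun z => ‖G z‖ ^ 2) 0 r :=
    (Continuous.continuousOn (by fun_prop)).circleIntegrable'
  have i2 : CircleIntegrable (fun z => (G z ^ 2).re) 0 r :=
    (Continuous.continuousOn (by fun_prop)).circleIntegrable'
  rw [h1, Real.circleAverage_fun_smul, Real.circleAverage_fun_add i1 i2, h3,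
    add_zero, smul_eq_mul]

end Flux

/-! ### The second variation -/

/-- Twofold differentiation of the quotient `I(ε)/(1 + ε²)` at `ε = 0`. -/
theorem secondDeriv_div_one_add_sq {I J K : ℝ → ℝ} {j : ℝ}
    (hI : ∀ᶠ ε in nhds 0, HasDerivAt I (J ε) ε) (hJ : ContDiffAt ℝ 1 J 0)
    (hj : HasDerivAt J j 0) (hK : ∀ᶠ ε in nhds 0, K ε = I ε / (1 + ε ^ 2)) :
    ContDiffAt ℝ 2 K 0 ∧ iteratedDeriv 2 K 0 = j - 2 * I 0 := by
  have hI2 : ContDiffAt ℝ 2 I 0 := by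
    have h : ContDiffAt ℝ ((1 : ℕ) + 1) I 0 := by
      refine contDiffAt_succ_iff_hasFDerivAt.2
        ⟨fun ε => ContinuousLinearMap.toSpanSingleton ℝ (J ε),
          ⟨_, hI, fun ε hε => hε.hasFDerivAt⟩, ?_⟩
      exact (ContinuousLinearMap.toSpanSingletonCLE (𝕜 := ℝ) (E := ℝ)).contDiff.contDiffAt.comp 0 hJ
    simpa [one_add_one_eq_two] using h
  have hden : ∀ ε : ℝ, 1 + ε ^ 2 ≠ 0 := fun ε => by positivity
  refine ⟨(hI2.div (by fun_prop) (hden 0)).congr_of_eventuallyEq hK, ?_⟩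
  have hsq : ∀ ε : ℝ, HasDerivAt (fun ε : ℝ => 1 + ε ^ 2) (2 * ε) ε := fun ε => by
    simpa using (hasDerivAt_pow 2 ε).const_add 1
  have h1 : deriv K =ᶠ[nhds 0] fun ε =>
      (J ε * (1 + ε ^ 2) - I ε * (2 * ε)) / (1 + ε ^ 2) ^ 2 := by
    have hK' : deriv K =ᶠ[nhds 0] deriv fun ε => I ε / (1 + ε ^ 2) :=
      Filter.EventuallyEq.deriv hK
    filter_upwards [hK', hI] with ε h2 h3
    rw [h2, (h3.fun_div (hsq ε) (hden ε)).deriv]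
  rw [iteratedDeriv_succ, iteratedDeriv_one, h1.deriv_eq]
  have hI0 := hI.self_of_nhds
  have hlin : HasDerivAt (fun ε : ℝ => 2 * ε) 2 0 := by
    simpa using (hasDerivAt_id (0 : ℝ)).const_mul 2
  have hnum := (hj.fun_mul (hsq 0)).fun_sub (hI0.fun_mul hlin)
  have hsq2 := (hsq 0).fun_pow 2
  rw [(hnum.fun_div hsq2 (by norm_num)).deriv]
  norm_num
  ring

theorem circleAverage_gaussDensity (r : ℝ) :
    Real.circleAverage gaussDensity 0 r = Real.exp (-Real.pi * r ^ 2) := by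
  refine Real.circleAverage_const_on_circle fun z hz => ?_
  simp only [mem_sphere_iff_norm, sub_zero] at hz
  simp only [gaussDensity, hz, sq_abs]

theorem integral_gaussDensity : ∫ z, gaussDensity z = 1 := by
  have hc := contDiff_gaussDensity.continuous
  rw [integral_eq_integral_circleAverage hc.stronglyMeasurable
    (integrable_exp_neg_mul_norm_sq Real.pi_pos)]
  refine Eq.trans ?_ ((integral_gaussian_moment 0).trans (by simp))
  refine setIntegral_congr_fun measurableSet_Ioi fun r _ => ?_
  simp only [circleAverage_gaussDensity, smul_eq_mul, mul_zero, pow_zero, one_mul]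

theorem setIntegral_ball_gaussDensity {ρ : ℝ} (hρ : 0 ≤ ρ) :
    ∫ z in Metric.ball 0 ρ, gaussDensity z = 1 - Real.exp (-(Real.pi * ρ ^ 2)) := by
  have hc := contDiff_gaussDensity.continuous
  rw [setIntegral_ball_eq_integral_circleAverage hc.stronglyMeasurable
    (integrable_exp_neg_mul_norm_sq Real.pi_pos).integrableOn]
  refine Eq.trans ?_ ((integral_gaussian_moment_Ioo 0 hρ).trans (by simp))
  refine setIntegral_congr_fun measurableSet_Ioo fun r _ => ?_
  simp only [circleAverage_gaussDensity, smul_eq_mul, mul_zero, pow_zero, one_mul]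

section SecondVariation

variable {G : ℂ → ℂ}

theorem fockNorm_one_add_sq (hm : G ∈ fockSpace) (h0 : fockInner G (fun _ => 1) = 0) (ε : ℝ) :
    fockNorm (fun z => 1 + (ε : ℂ) * G z) ^ 2 = 1 + ε ^ 2 * fockNorm G ^ 2 := by
  have hone : (fun _ : ℂ => (1 : ℂ)) ∈ fockSpace := by
    simpa using pow_mem_fockSpace 0
  have hi := integrable_fockInner hm hone
  have hcross : ∀ z, crossDensity G z = 2 * (G z * (starRingEnd ℂ) (1 : ℂ) *
      (Real.exp (-Real.pi * ‖z‖ ^ 2) : ℂ)).re := fun z => by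
    rw [map_one, mul_one, Complex.re_mul_ofReal, crossDensity, mul_assoc]
  have i1 : Integrable fun z => ε * crossDensity G z := by
    simp_rw [hcross]
    exact (hi.re.const_mul 2).const_mul ε
  have i0 : Integrable gaussDensity := integrable_exp_neg_mul_norm_sq Real.pi_pos
  have i01 : Integrable fun z => gaussDensity z + ε * crossDensity G z := i0.add i1
  have i2 : Integrable fun z => ε ^ 2 * fockDensity G z := hm.2.const_mul _
  have hzero : ∫ z, crossDensity G z = 0 := by
    simp_rw [hcross]
    rw [integral_const_mul]
    have h := integral_re hi
    rw [fockInner] at h0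
    simp only [RCLike.re_eq_complex_re] at h
    rw [h, h0]
    simp
  have heq : (fun z => fockDensity (fun z => 1 + (ε : ℂ) * G z) z) = fun z =>
      gaussDensity z + ε * crossDensity G z + ε ^ 2 * fockDensity G z :=
    funext fun z => perturbedDensity_eq G ε z
  rw [fockNorm_sq, fockNorm_sq, heq, integral_add i01 i2, integral_add i0 i1, integral_const_mul,
    integral_const_mul, integral_gaussDensity, hzero]
  ring

/-- The second variation in terms of `|G|²`: the first term is the flux through the boundary of the
disc `π|z|² = s`, the second the energy of `G` inside it, and the third comes from the
normalization. -/
theorem fockKLine_secondVariation (hm : G ∈ fockSpace) (hnorm : fockNorm G = 1)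
    (hinner : fockInner G (fun _ => 1) = 0) (h0 : G 0 = 0) {ρ : ℝ} (hρ : 0 < ρ) :
    ContDiffAt ℝ 2 (fockKLine (Real.pi * ρ ^ 2) G) 0 ∧
      fockSecondVariation (Real.pi * ρ ^ 2) G =
        2 * Real.exp (-(Real.pi * ρ ^ 2)) * Real.circleAverage (fun z => ‖G z‖ ^ 2) 0 ρ +
          2 * (∫ z in Metric.ball 0 ρ, fockDensity G z) -
          2 * (1 - Real.exp (-(Real.pi * ρ ^ 2))) := by
  have hd : Differentiable ℂ G := hm.1
  set s := Real.pi * ρ ^ 2 with hs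
  have h₁ : 0 < ρ / 2 := by positivity
  have h₁₀ : ρ / 2 < ρ := by linarith
  have h₀₂ : ρ < ρ + 1 := by linarith
  have h₁₂ := h₁₀.trans h₀₂
  obtain ⟨V, hVreg, hV, hp₀⟩ := eventually_nhds_iff.1 (eventually_regularLevel hm h₁ h₁₀ h₀₂)
  rw [← hs] at hp₀
  set p₀ : ℝ × ℝ := (0, Real.exp (-s)) with hp₀def
  set R := levelRadius G
  have hR : ContDiffOn ℝ 1 R (V ×ˢ Set.univ) := contDiffOn_levelRadius hd h₁ h₁₂ hV hVreg
  have c0 := contDiff_gaussDensity.continuous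
  have c1 := (contDiff_crossDensity hd).continuous
  have c2 := (contDiff_fockDensity hd).continuous
  have cone : Continuous fun _ : ℂ => (1 : ℝ) := continuous_const
  have hC1 : ∀ {f : ℂ → ℝ}, Continuous f → ContDiffAt ℝ 1 (starIntegral R f) p₀ := fun hf =>
    contDiffAt_one_iff.2 ⟨starFlux R _, V, hV.mem_nhds hp₀,
      (hasFDerivAt_starIntegral hV hR hf).2, (hasFDerivAt_starIntegral hV hR hf).1⟩
  have hball : superlevel G p₀ = Metric.ball 0 ρ := by
    ext z
    simp only [superlevel, hp₀def, perturbedDensity_zero, gaussDensity, Set.mem_ofPred_eq,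
      Real.exp_lt_exp, mem_ball_zero_iff, hs, neg_mul, neg_lt_neg_iff,
      mul_lt_mul_iff_right₀ Real.pi_pos]
    exact pow_lt_pow_iff_left₀ (norm_nonneg z) hρ.le two_ne_zero
  have hbase : ∀ {f : ℂ → ℝ}, Continuous f →
      starIntegral R f p₀ = ∫ z in Metric.ball 0 ρ, f z := fun hf => by
    rw [← hball, (hVreg p₀ hp₀).setIntegral_superlevel hd h₁ h₁₂ hf]
  have hflux : ∀ {f : ℂ → ℝ}, Continuous f → ∀ v : ℝ × ℝ, starFlux R f p₀ v =
      Real.exp s * (v.1 * Real.circleAverage (fun z => f z * crossDensity G z) 0 ρ -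
        v.2 * Real.circleAverage f 0 ρ) := fun hf v =>
    starFlux_base hd h₁ h₁₀ h₀₂ hV hVreg hp₀ hf v
  have harea : starIntegral R (fun _ => 1) p₀ = s := by
    rw [hbase cone, setIntegral_const, smul_eq_mul, mul_one, measureReal_def, Complex.volume_ball]
    simp [hρ.le, hs, mul_comm]
  -- The level `t = φ ε` at which the super-level set of `1 + ε G` has measure `s`.
  have hdt : HasDerivAt (fun t => starIntegral R (fun _ => 1) ((0 : ℝ), t))
      (starFlux R (fun _ => 1) p₀ (0, 1)) (Real.exp (-s)) :=
    HasFDerivAt.comp_hasDerivAt (f := fun t : ℝ => ((0 : ℝ), t)) (Real.exp (-s))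
      ((hasFDerivAt_starIntegral hV hR cone).1 p₀ hp₀)
      ((hasDerivAt_const _ _).prodMk (hasDerivAt_id _))
  have hdt0 : starFlux R (fun _ => 1) p₀ (0, 1) ≠ 0 := by
    rw [hflux cone, Real.circleAverage_const]
    simp [(Real.exp_pos s).ne']
  obtain ⟨φ, hφ, hφ0, hφe⟩ := exists_contDiffAt_implicit (hC1 cone) hdt hdt0
  set q : ℝ → ℝ × ℝ := fun ε => (ε, φ ε) with hq
  have hq0 : q 0 = p₀ := by rw [hq, hp₀def]; simp only [hφ0]
  have hqC : ContDiffAt ℝ 1 q 0 := contDiffAt_id.prodMk hφ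
  have hqV : ∀ᶠ ε in nhds 0, q ε ∈ V :=
    hqC.continuousAt.eventually_mem (hV.mem_nhds (by rw [hq0]; exact hp₀))
  have hφd : ∀ᶠ ε in nhds 0, HasDerivAt φ (deriv φ ε) ε :=
    (hφ.eventually (by simp)).mono fun ε h => (h.differentiableAt one_ne_zero).hasDerivAt
  have hqd : ∀ ε, HasDerivAt φ (deriv φ ε) ε → HasDerivAt q (1, deriv φ ε) ε := fun ε h =>
    (hasDerivAt_id ε).prodMk h
  have hstar : ∀ {f : ℂ → ℝ}, Continuous f → ∀ ε, q ε ∈ V → HasDerivAt φ (deriv φ ε) ε →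
      HasDerivAt (fun ε => starIntegral R f (q ε)) (starFlux R f (q ε) (1, deriv φ ε)) ε :=
    fun hf ε h1 h2 => HasFDerivAt.comp_hasDerivAt ε
      ((hasFDerivAt_starIntegral hV hR hf).1 (q ε) h1) (hqd ε h2)
  have hstarC : ∀ {f : ℂ → ℝ}, Continuous f →
      ContDiffAt ℝ 1 (fun ε => starIntegral R f (q ε)) 0 := fun hf => by
    have h := hC1 hf
    rw [← hq0] at h
    exact h.comp (0 : ℝ) hqC
  have hconst : ∀ᶠ ε in nhds 0, starIntegral R (fun _ => 1) (q ε) = s := by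
    have : ∀ᶠ ε in nhds (0 : ℝ), starIntegral R (fun _ => 1) (ε, φ ε) =
        starIntegral R (fun _ => 1) (0, Real.exp (-s)) := hφe
    exact this.mono fun ε h => h.trans harea
  set I : ℝ → ℝ := fun ε => starIntegral R gaussDensity (q ε) +
    ε * starIntegral R (crossDensity G) (q ε) +
    ε ^ 2 * starIntegral R (fockDensity G) (q ε) with hI
  set J : ℝ → ℝ := fun ε => starIntegral R (crossDensity G) (q ε) +
    2 * ε * starIntegral R (fockDensity G) (q ε) with hJ
  have hK : ∀ᶠ ε in nhds 0, fockKLine s G ε = I ε / (1 + ε ^ 2) := by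
    filter_upwards [hqV, hconst] with ε h1 h2
    have h3 := (hVreg _ h1).fockConcentration_eq hd h₁ h₁₂ h2
    simp only [fockKLine, fockK]
    rw [fockNorm_one_add_sq hm hinner, hnorm, one_pow, mul_one]
    exact congrArg (· / (1 + ε ^ 2)) h3
  have hId : ∀ᶠ ε in nhds 0, HasDerivAt I (J ε) ε := by
    filter_upwards [hqV, hφd, hconst.eventually_nhds] with ε h1 h2 h3
    set v : ℝ × ℝ := (1, deriv φ ε)
    have harea0 : starFlux R (fun _ => 1) (q ε) v = 0 :=
      (hstar cone ε h1 h2).unique ((hasDerivAt_const ε s).congr_of_eventuallyEq h3)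
    -- On the boundary the density equals `φ ε`, so its flux is that of the constant `φ ε`.
    have hbd : starFlux R gaussDensity (q ε) v + ε * starFlux R (crossDensity G) (q ε) v +
        ε ^ 2 * starFlux R (fockDensity G) (q ε) v =
          φ ε * starFlux R (fun _ => 1) (q ε) v := by
      have hint : ∀ {f : ℂ → ℝ}, Continuous f → IntervalIntegrable (fun θ =>
          R (q ε, θ) * f (circleMap 0 (R (q ε, θ)) θ) * fderiv ℝ R (q ε, θ) (v, 0))
          volume (-Real.pi) Real.pi := fun hf => by
        have hc := (continuousOn_starFlux_integrand hV hR hf).comp_continuous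
          (f := fun θ : ℝ => (q ε, θ)) (by fun_prop) fun _ => ⟨h1, Set.mem_univ _⟩
        refine Continuous.intervalIntegrable ?_ _ _
        simpa using hc.clm_apply (continuous_const (y := v))
      simp only [starFlux_apply hV hR c0 h1, starFlux_apply hV hR c1 h1,
        starFlux_apply hV hR c2 h1, starFlux_apply hV hR cone h1]
      rw [← intervalIntegral.integral_const_mul, ← intervalIntegral.integral_const_mul,
        ← intervalIntegral.integral_const_mul,
        ← intervalIntegral.integral_add (hint c0) ((hint c1).const_mul _),
        ← intervalIntegral.integral_add ((hint c0).add ((hint c1).const_mul _))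
          ((hint c2).const_mul _)]
      refine intervalIntegral.integral_congr fun θ _ => ?_
      have h4 : perturbedDensity G ε (circleMap 0 (R (q ε, θ)) θ) = φ ε :=
        ((hVreg _ h1).levelRadius_spec hd h₁ h₁₂ θ).2.1
      rw [perturbedDensity_eq] at h4
      linear_combination (R (q ε, θ) * fderiv ℝ R (q ε, θ) (v, 0)) * h4
    have hsum := ((hstar c0 ε h1 h2).fun_add ((hasDerivAt_id ε).fun_mul (hstar c1 ε h1 h2))).fun_add
      ((hasDerivAt_pow 2 ε).fun_mul (hstar c2 ε h1 h2))
    refine hsum.congr_deriv ?_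
    rw [harea0, mul_zero] at hbd
    simp only [hJ, id]
    push_cast
    linear_combination hbd
  have hJC : ContDiffAt ℝ 1 J 0 :=
    (hstarC c1).add ((contDiffAt_const.mul contDiffAt_id).mul (hstarC c2))
  have hJd : HasDerivAt J (starFlux R (crossDensity G) p₀ (1, deriv φ 0) +
      2 * starIntegral R (fockDensity G) p₀) 0 := by
    have h1 := hstar c1 0 hqV.self_of_nhds hφd.self_of_nhds
    have h2 := hstar c2 0 hqV.self_of_nhds hφd.self_of_nhds
    have hlin : HasDerivAt (fun ε : ℝ => 2 * ε) 2 0 := by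
      simpa using (hasDerivAt_id (0 : ℝ)).const_mul 2
    refine (h1.fun_add (hlin.fun_mul h2)).congr_deriv ?_
    rw [hq0]
    ring
  obtain ⟨hA, hB⟩ := secondDeriv_div_one_add_sq hId hJC hJd hK
  refine ⟨hA, hB.trans ?_⟩
  have hI0 : I 0 = 1 - Real.exp (-s) := by
    simp only [hI, hq0, hbase c0, setIntegral_ball_gaussDensity hρ.le]
    simp [hs]
  have hee : Real.exp s * Real.exp (-s) = 1 := by
    rw [← Real.exp_add, add_neg_cancel, Real.exp_zero]
  rw [hI0, hflux c1, circleAverage_crossDensity hd h0, circleAverage_crossDensity_sq hd h0,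
    hbase c2, ← hs]
  linear_combination (2 * Real.exp (-s) * Real.circleAverage (fun z => ‖G z‖ ^ 2) 0 ρ) * hee

end SecondVariation

/-! ### Evaluation on power series -/

section Main

variable {G : ℂ → ℂ} {a : ℕ → ℂ}

theorem fockV_le {s : ℝ} (hs : 0 ≤ s) {k : ℕ} (hk : 2 ≤ k) : fockV s k ≤ -s * Real.exp (-s) := by
  have h : s ≤ ∑ j ∈ Finset.Ico 1 k, s ^ j / (j.factorial : ℝ) := by
    have h1 := Finset.single_le_sum (f := fun j : ℕ => s ^ j / (j.factorial : ℝ))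
      (s := Finset.Ico 1 k) (fun j _ => by positivity)
      (Finset.mem_Ico.2 ⟨le_rfl, by omega⟩ : 1 ∈ Finset.Ico 1 k)
    simpa using h1
  rw [fockV]
  nlinarith [Real.exp_pos (-s)]

theorem fockV_eq (s : ℝ) {k : ℕ} (hk : 1 ≤ k) :
    fockV s k = Real.exp (-s) * (s ^ k / (k.factorial : ℝ)) +
      (1 - Real.exp (-s) * ∑ j ∈ Finset.range (k + 1), s ^ j / (j.factorial : ℝ)) -
        (1 - Real.exp (-s)) := by
  rw [Finset.sum_range_succ, Finset.range_eq_Ico, Finset.sum_eq_sum_Ico_succ_bot (by omega), fockV]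
  simp
  ring

/-- The second variation is diagonal in the normalized monomials, with eigenvalues `V_k(s)`. -/
theorem hasSum_fockSecondVariation (hG : FockAdmissible G)
    (ha : ∀ z, HasSum (fun k => a k * fockMonomial k z) (G z)) (ha0 : a 0 = 0)
    {s : ℝ} (hs : 0 < s) :
    ContDiffAt ℝ 2 (fockKLine s G) 0 ∧
      HasSum (fun k => ‖a k‖ ^ 2 * fockV s k) ((1 / 2 : ℝ) * fockSecondVariation s G) := by
  obtain ⟨hm, hnorm, hone, -⟩ := hG
  have hρ : 0 < Real.sqrt (s / Real.pi) := by positivity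
  have hsρ : Real.pi * Real.sqrt (s / Real.pi) ^ 2 = s := by
    rw [Real.sq_sqrt (by positivity)]
    field_simp
  have h0 : G 0 = 0 := by
    refine (ha 0).unique ?_
    convert! hasSum_zero (α := ℂ) (β := ℕ) using 1
    ext k
    rcases Nat.eq_zero_or_pos k with rfl | hk
    · simp [ha0]
    · simp [fockMonomial, hk.ne']
  have h := fockKLine_secondVariation hm hnorm hone h0 hρ
  rw [hsρ] at h
  refine ⟨h.1, ?_⟩
  have h1 := hasSum_circleAverage_fockMonomial hm ha (Real.sqrt (s / Real.pi))
  have h2 := hasSum_setIntegral_ball_fockMonomial hm ha hρ.le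
  have h3 := hasSum_norm_sq_fockMonomial hm ha
  rw [hnorm, one_pow] at h3
  rw [hsρ] at h1 h2
  have h4 := ((h1.mul_left (Real.exp (-s))).add h2).sub (h3.mul_right (1 - Real.exp (-s)))
  rw [h.2]
  convert! h4 using 1
  · ext k
    rcases Nat.eq_zero_or_pos k with rfl | hk
    · simp [ha0]
    · rw [fockV_eq s hk]
      ring
  · ring

theorem fockAdmissible_mul_sq {c : ℂ} (hc : ‖c‖ = Real.pi / Real.sqrt 2) :
    FockAdmissible (fun z => c * z ^ 2) ∧
      ∃ b : ℂ, ‖b‖ = 1 ∧ ∀ z, HasSum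
        (fun k => (Pi.single 2 b : ℕ → ℂ) k * fockMonomial k z) (c * z ^ 2) := by
  have hm : (fun z => c * z ^ 2) ∈ fockSpace := fockSpace.smul_mem c (pow_mem_fockSpace 2)
  have hq : Real.sqrt (Real.pi ^ 2 / ((2 : ℕ).factorial : ℝ)) = Real.pi / Real.sqrt 2 := by
    rw [Real.sqrt_div (by positivity), Real.sqrt_sq Real.pi_pos.le]
    norm_num
  have hq0 : Real.pi / Real.sqrt 2 ≠ 0 := by positivity
  set b : ℂ := c / ((Real.pi / Real.sqrt 2 : ℝ) : ℂ) with hb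
  have hb1 : ‖b‖ = 1 := by
    rw [hb, norm_div, hc, Complex.norm_real, Real.norm_of_nonneg (by positivity), div_self hq0]
  have ha : ∀ z, HasSum (fun k => (Pi.single 2 b : ℕ → ℂ) k * fockMonomial k z) (c * z ^ 2) := by
    intro z
    have h := hasSum_single (f := fun k => (Pi.single 2 b : ℕ → ℂ) k * fockMonomial k z) 2
      fun k hk => by simp [Pi.single_eq_of_ne hk]
    convert! h using 1
    rw [Pi.single_eq_same, fockMonomial, hq, ← mul_assoc, hb,
      div_mul_cancel₀ _ (Complex.ofReal_ne_zero.2 hq0)]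
  refine ⟨⟨hm, ?_, ?_, ?_⟩, b, hb1, ha⟩
  · have h1 := hasSum_norm_sq_fockMonomial hm ha
    have h2 := hasSum_single (f := fun k => ‖(Pi.single 2 b : ℕ → ℂ) k‖ ^ 2) 2
      fun k hk => by simp [Pi.single_eq_of_ne hk]
    have h3 := h1.unique h2
    rw [Pi.single_eq_same, hb1] at h3
    exact (pow_left_inj₀ (Real.sqrt_nonneg _) zero_le_one two_ne_zero).1 h3
  · simpa using (fockInner_pow_eq_zero_iff hm ha 0).2 (by simp)
  · simpa using (fockInner_pow_eq_zero_iff hm ha 1).2 (by simp)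

end Main

theorem mainTheorem8 (s : ℝ) (hs : 0 < s) :
    (∀ G : ℂ → ℂ, FockAdmissible G →
      ContDiffAt ℝ 2 (fockKLine s G) 0 ∧
      (1 / 2 : ℝ) * fockSecondVariation s G ≤ -s * Real.exp (-s) ∧
      ∃ a : ℕ → ℂ, a 0 = 0 ∧ a 1 = 0 ∧
        (∀ z : ℂ, HasSum (fun k : ℕ => a k * fockMonomial k z) (G z)) ∧
        HasSum (fun k : ℕ => ‖a k‖ ^ 2) 1 ∧
        HasSum (fun k : ℕ => ‖a k‖ ^ 2 * fockV s k)
          ((1 / 2 : ℝ) * fockSecondVariation s G)) ∧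
    (∀ c : ℂ, ‖c‖ = Real.pi / Real.sqrt 2 →
      FockAdmissible (fun z => c * z ^ 2) ∧
      (1 / 2 : ℝ) * fockSecondVariation s (fun z => c * z ^ 2) = -s * Real.exp (-s)) := by
  refine ⟨fun G hG => ?_, fun c hc => ?_⟩
  · obtain ⟨a, ha⟩ := exists_hasSum_fockMonomial hG.mem.1
    have ha0 : a 0 = 0 := (fockInner_pow_eq_zero_iff hG.mem ha 0).1 (by simpa using hG.inner_one)
    have ha1 : a 1 = 0 := (fockInner_pow_eq_zero_iff hG.mem ha 1).1 (by simpa using hG.inner_id)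
    obtain ⟨hC, hsum⟩ := hasSum_fockSecondVariation hG ha ha0 hs
    have hnorm := hasSum_norm_sq_fockMonomial hG.mem ha
    rw [hG.norm_eq_one, one_pow] at hnorm
    refine ⟨hC, ?_, a, ha0, ha1, ha, hnorm, hsum⟩
    have h := hasSum_le (fun k => ?_) hsum (hnorm.mul_right (-s * Real.exp (-s)))
    · simpa using h
    · rcases Nat.lt_or_ge k 2 with hk | hk
      · interval_cases k <;> simp [ha0, ha1]
      · exact mul_le_mul_of_nonneg_left (fockV_le hs.le hk) (by positivity)
  · obtain ⟨hG, b, hb, ha⟩ := fockAdmissible_mul_sq hc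
    refine ⟨hG, ?_⟩
    have h1 := (hasSum_fockSecondVariation hG ha (by simp) hs).2
    have h2 := hasSum_single (f := fun k => ‖(Pi.single 2 b : ℕ → ℂ) k‖ ^ 2 * fockV s k) 2
      fun k hk => by simp [Pi.single_eq_of_ne hk]
    rw [h1.unique h2, Pi.single_eq_same, hb, fockV]
    norm_num
    ring
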